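/- Let $G$ be a finite simple connected graph that is $d$-regular and edge-transitive, with $N$ vertices, and let $ab$ be an edge of $G$. Let $G_b$ be the bipartite double graph of $G$: its vertices are $v_{\mathrm{out}}, v_{\mathrm{in}}$ for the vertices $v$ of $G$, and each edge $\{u,v\}$ of $G$ gives the two edges $\{u_{\mathrm{out}},v_{\mathrm{in}}\}$ and $\{v_{\mathrm{out}},u_{\mathrm{in}}\}$. The resistance distance $\Omega_{x,y}$ is the effective resistance between $x$ and $y$ when every edge is a unit resistor. Consider the quantum walk $U=S(I\otimes C)$ on the space with orthonormal basis $|uv\rangle$, one vector for each ordered pair of adjacent vertices, where $C=2|s_c\rangle\langle s_c|-I$ is the Grover coin ($|s_c\rangle$ is the equal superposition of the $d$ directions at a vertex) and $S|uv\rangle=|vu\rangle$. A flip state is a vector whose amplitudes have, at each vertex, outgoing sum $\sum_{v\sim u}\langle uv|\phi\rangle=0$ and incoming sum $\sum_{v\sim u}\langle vu|\phi\rangle=0$. The flip weight $|\alpha|^2$ of a state is the squared norm of its orthogonal projection to the space of flip states. 1. (Resistance.) $\Omega_{a,b}=\frac{N-1}{dN/2}$ in $G$. In $G_b$, $\Omega_{a_{\mathrm{out}},b_{\mathrm{in}}}=\frac{2N-1}{dN}$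 if $G$ is not bipartite, and $\Omega_{a_{\mathrm{out}},b_{\mathrm{in}}}=\Omega_{a,b}=\frac{N-1}{dN/2}$ if $G$ is bipartite. 2. (Flip weight.) The flip weight of $(|ab\rangle-|ba\rangle)/\sqrt2$ is $\frac{dN-2N+2}{dN}$. The flip weight of $|ab\rangle$ is $\frac{dN-2N+1}{dN}$ if $G$ is not bipartite, and $\frac{dN-2N+2}{dN}$ if $G$ is bipartite. 3. (Oscillation and localization.) For all $t\ge 0$, both $|\langle ab|U^{2t}|ab\rangle|$ and $|\langle ba|U^{2t+1}|ab\rangle|$ are at least $1-2\,\frac{2N-1}{dN}$, and at least $1-2\,\frac{N-1}{dN/2}$ if $G$ is bipartite. With $\psi=(|ab\rangle-|ba\rangle)/\sqrt2$, also $|\langle\psi|U^{t}|\psi\rangle|\ge 1-2\,\frac{N-1}{dN/2}$ for all $t\ge0$. All these bounds exceed $1-\frac4d$. So for $d>4$, uniformly in $N$ and $t$, $|ab\rangle$ oscillates with $-|ba\rangle$ and $\psi$ is localized. 4. (Examples.) The following graphs are connected, regular of the stated degree and edge-transitive, so that for each of their edges the amplitudes in 3 are at least $1-4/(\text{degree})$: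 the complete graph on $n\ge1$ vertices (degree $n-1$), the complete bipartite graph $K_{n,n}$, $n\ge1$ (degree $n$), the $D$-dimensional hypercube (degree $D$), and the $D$-dimensional periodic square lattice $(\mathbb Z/n)^D$, $n\ge3$ (degree $2D$). 5. (Complete graph.) On the complete graph with $N\ge2$ vertices, let $a\ne b$ and let $|\sigma_V\rangle$ be the uniform superposition of all $|uv\rangle$. Then $|\langle ab|\sigma_V\rangle|^2=\frac1{N(N-1)}$, the flip weight of $|ab\rangle$ is $1-\frac1{N-1}-\frac1N$ if $N\ge3$, and for all $t\ge0$ $$|\langle ab|U^{2t}|ab\rangle|\ge1-\frac4N,\qquad |\langle ba|U^{2t+1}|ab\rangle|\ge1-\frac2{N-1}-\frac2N.$$ -/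

import Mathlib

open scoped InnerProductSpace

/-! ### Graphs and electric networks -/

/-- Any edge of `G` can be carried to any other edge of `G` by an automorphism of `G`. -/
def IsEdgeTransitive {V : Type*} (G : SimpleGraph V) : Prop :=
  ∀ e ∈ G.edgeSet, ∀ e' ∈ G.edgeSet, ∃ φ : G ≃g G, Sym2.map φ e = e'

/-- `v` is the electric potential (Kirchhoff's and Ohm's laws) in the network obtained from `G` by
replacing each edge by a unit resistor, when one unit of current is injected at `a` and extracted
at `b`: the current on the edge from `x` to `y` is `v x - v y`. -/
def IsUnitCurrentPotential {V : Type*} [Fintype V] [DecidableEq V] (G : SimpleGraph V)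
    [DecidableRel G.Adj] (a b : V) (v : V → ℝ) : Prop :=
  ∀ x, ∑ y ∈ G.neighborFinset x, (v x - v y) =
    (if x = a then (1 : ℝ) else 0) - (if x = b then (1 : ℝ) else 0)

/-- The resistance distance between `a` and `b` in `G` exists and equals `r`: a unit current can
flow from `a` to `b`, and it always causes the potential difference `r`. -/
def HasResistanceDistance {V : Type*} [Fintype V] [DecidableEq V] (G : SimpleGraph V)
    [DecidableRel G.Adj] (a b : V) (r : ℝ) : Prop :=
  (∃ v : V → ℝ, IsUnitCurrentPotential G a b v) ∧
    ∀ v : V → ℝ, IsUnitCurrentPotential G a b v → v a - v b = r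

instance (n : ℕ) : DecidableRel (completeBipartiteGraph (Fin n) (Fin n)).Adj :=
  fun x y => inferInstanceAs (Decidable (x.isLeft ∧ y.isRight ∨ x.isRight ∧ y.isLeft))

/-- The `D`-dimensional hypercube: bit strings, adjacent when they differ in exactly one bit. -/
def hypercube (D : ℕ) : SimpleGraph (Fin D → Bool) where
  Adj x y := hammingDist x y = 1
  symm := ⟨fun x y h => by rwa [hammingDist_comm]⟩
  loopless := ⟨fun x h => by simp at h⟩

instance (D : ℕ) : DecidableRel (hypercube D).Adj :=
  fun x y => inferInstanceAs (Decidable (hammingDist x y = 1))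

/-- The `D`-dimensional periodic square lattice of side `n`: points of `(ℤ/n)^D`, adjacent when
they are distinct and differ by one unit step along one coordinate. -/
def squareLattice (D n : ℕ) : SimpleGraph (Fin D → ZMod n) where
  Adj x y := x ≠ y ∧ ∃ i, (y i = x i + 1 ∨ x i = y i + 1) ∧ ∀ j, j ≠ i → x j = y j
  symm := ⟨fun _ _ ⟨h, i, hi, hj⟩ => ⟨h.symm, i, hi.symm, fun j hji => (hj j hji).symm⟩⟩
  loopless := ⟨fun _ h => h.1 rfl⟩

instance (D n : ℕ) : DecidableRel (squareLattice D n).Adj :=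
  fun x y => inferInstanceAs
    (Decidable (x ≠ y ∧ ∃ i, (y i = x i + 1 ∨ x i = y i + 1) ∧ ∀ j, j ≠ i → x j = y j))

/-! ### The quantum walk -/

/-- The state space of the walk. A dart `(u, v)` is the basis state `|uv⟩`: the walker is at `u`
and points towards `v`. -/
abbrev WalkSpace {V : Type*} [Fintype V] (G : SimpleGraph V) [DecidableRel G.Adj] : Type _ :=
  EuclideanSpace ℂ G.Dart

noncomputable section

section Walk

variable {V : Type*} [Fintype V] [DecidableEq V] (G : SimpleGraph V) [DecidableRel G.Adj]

/-- The basis state `|uv⟩`. -/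
def ket {u v : V} (h : G.Adj u v) : WalkSpace G :=
  EuclideanSpace.single (⟨(u, v), h⟩ : G.Dart) (1 : ℂ)

/-- The state `|u⟩ ⊗ |s_c⟩`: the walker is at `u`, in equal superposition over the directions. -/
def coinState (u : V) : WalkSpace G :=
  WithLp.toLp 2 fun e : G.Dart => if e.fst = u then ((1 / √(G.degree u : ℝ) : ℝ) : ℂ) else 0

/-- The operator `I ⊗ C` with the Grover coin `C = 2 |s_c⟩⟨s_c| - I`. -/
def groverCoin : WalkSpace G →L[ℂ] WalkSpace G :=
  (2 : ℂ) • ∑ u, InnerProductSpace.rankOne ℂ (coinState G u) (coinState G u) - 1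

/-- The flip-flop shift `S |uv⟩ = |vu⟩`. -/
def flipFlopShift : WalkSpace G →L[ℂ] WalkSpace G :=
  (LinearIsometryEquiv.piLpCongrLeft 2 ℂ ℂ
    (SimpleGraph.Dart.symm_involutive (G := G)).toPerm).toContinuousLinearEquiv

/-- One step `U = S (I ⊗ C)` of the quantum walk. -/
def walkStep : WalkSpace G →L[ℂ] WalkSpace G :=
  flipFlopShift G * groverCoin G

/-- The average outgoing amplitude at `u`. -/
def avgOut (ψ : WalkSpace G) (u : V) : ℂ :=
  (1 / (G.degree u : ℂ)) * ∑ e : G.Dart with e.fst = u, ψ e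

/-- The average incoming amplitude at `u`. -/
def avgIn (ψ : WalkSpace G) (u : V) : ℂ :=
  (1 / (G.degree u : ℂ)) * ∑ e : G.Dart with e.snd = u, ψ e

/-- The subspace of (not necessarily normalized) flip states: those whose average outgoing and
average incoming amplitudes vanish at every vertex. -/
def flipStates : Submodule ℂ (WalkSpace G) where
  carrier := {ψ | ∀ u, avgOut G ψ u = 0 ∧ avgIn G ψ u = 0}
  zero_mem' := fun u => by simp [avgOut, avgIn]
  add_mem' := fun {ψ χ} hψ hχ u => by
    have h1 := hψ u
    have h2 := hχ u
    simp only [avgOut, avgIn, PiLp.add_apply, Finset.sum_add_distrib, mul_add] at h1 h2 ⊢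
    rw [h1.1, h1.2, h2.1, h2.2]
    simp
  smul_mem' := fun c ψ hψ u => by
    have h1 := hψ u
    simp only [avgOut, avgIn, PiLp.smul_apply, smul_eq_mul, ← Finset.mul_sum] at h1 ⊢
    rw [mul_left_comm, h1.1, mul_left_comm, h1.2]
    simp

/-- The weight `|α|²` of `ψ` on the flip states, i.e. the squared norm of the flip state that is
closest to `ψ` (the orthogonal projection of `ψ` to the flip states). -/
def flipWeight (ψ : WalkSpace G) : ℝ :=
  ‖(flipStates G).starProjection ψ‖ ^ 2

/-- The uniform state `|σ_V⟩` of a graph on `N` vertices that is regular of degree `d`: every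
amplitude is `1 / √(d N)`; here `d N` is the number of darts. -/
def uniformState : WalkSpace G :=
  WithLp.toLp 2 fun _ : G.Dart => ((1 / √(Fintype.card G.Dart : ℝ) : ℝ) : ℂ)

/-- The state `(|ab⟩ - |ba⟩) / √2`. -/
def edgeState {a b : V} (h : G.Adj a b) : WalkSpace G :=
  ((1 / √2 : ℝ) : ℂ) • (ket G h - ket G h.symm)

/-- At all even times the walk started in `ψ` has amplitude at least `c` in `ψ`, and at all odd
times it has amplitude at least `c` in `ψ'`. For `c > 0` it oscillates between `ψ` and `ψ'`. -/
def OscillatesBetween (c : ℝ) (ψ ψ' : WalkSpace G) : Prop :=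
  ∀ t : ℕ, c ≤ ‖⟪ψ, (walkStep G ^ (2 * t)) ψ⟫_ℂ‖ ∧ c ≤ ‖⟪ψ', (walkStep G ^ (2 * t + 1)) ψ⟫_ℂ‖

/-- At all times the walk started in `ψ` has amplitude at least `c` in `ψ`. For `c > 0` the state
`ψ` is localized (stationary). -/
def StaysLocalized (c : ℝ) (ψ : WalkSpace G) : Prop :=
  ∀ t : ℕ, c ≤ ‖⟪ψ, (walkStep G ^ t) ψ⟫_ℂ‖

/-- For every edge `ab`, the walk oscillates between `|ab⟩` and `-|ba⟩`, and
`(|ab⟩ - |ba⟩) / √2` is localized, with amplitudes at least `c`. -/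
def LocalizesOnEdges (c : ℝ) : Prop :=
  ∀ (a b : V) (h : G.Adj a b),
    OscillatesBetween G c (ket G h) (-ket G h.symm) ∧ StaysLocalized G c (edgeState G h)

end Walk

end

/-! ### Resistance distance across edges -/

section Resistance

variable {V : Type*} [Fintype V] {G : SimpleGraph V} [DecidableRel G.Adj]

/-! Read the amplitude of the dart `(u, v)` as a current on the edge from `u_out` to `v_in` of the
bipartite double graph. Flip states are then the circulations (Kirchhoff's law without sources), and
every potential drop `f u - g v` is orthogonal to them. Subtracting from `|ab⟩` the current caused
by a unit source at `a_out` and a unit sink at `b_in` leaves a circulation, which is therefore the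
projection of `|ab⟩`. Its `ab` entry is the flip weight, one minus the resistance
(`flipWeight_ket`). For the antisymmetric edge state one potential on `G` serves both copies, so the
resistance in `G` itself appears (`flipWeight_edgeState`).

By Foster's theorem the resistances across all edges sum to the number of vertices minus one, and
edge-transitivity makes them equal (`exists_hasResistanceDistance_of_forall_adj`). The double graph
inherits edge-transitivity. It is connected when `G` is not bipartite, and otherwise consists of two
copies of `G`.

On flip states the coin is `-1`, so `U = -S` and `U ^ 2 = 1`; the orthogonal complement is
invariant. The flip component, of weight `p`, thus returns exactly, while the rest can cancel at
most `1 - p`, so the amplitude is at least `2 * p - 1` (`two_mul_sub_one_le_norm_inner`). On the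
complete graph the even-time bound improves by adding the weight on the uniform state, which is
fixed by `U` and orthogonal to the flip states. -/

theorem sum_neighborFinset_eq_sum_ite {M : Type*} [AddCommMonoid M] (x : V) (F : V → M) :
    ∑ y ∈ G.neighborFinset x, F y = ∑ y, if G.Adj x y then F y else 0 := by
  rw [← Finset.sum_filter, SimpleGraph.neighborFinset_eq_filter]

theorem sum_sum_neighborFinset_comm {M : Type*} [AddCommMonoid M] (F : V → V → M) :
    ∑ x, ∑ y ∈ G.neighborFinset x, F x y = ∑ x, ∑ y ∈ G.neighborFinset x, F y x := by
  simp_rw [sum_neighborFinset_eq_sum_ite]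
  rw [Finset.sum_comm]
  simp_rw [G.adj_comm]

theorem sum_neighborFinset_iso {W M : Type*} [Fintype W] {H : SimpleGraph W}
    [DecidableRel H.Adj] [AddCommMonoid M] (φ : G ≃g H) (x : V) (F : W → M) :
    ∑ y ∈ H.neighborFinset (φ x), F y = ∑ y ∈ G.neighborFinset x, F (φ y) := by
  simp_rw [sum_neighborFinset_eq_sum_ite]
  rw [← φ.toEquiv.sum_comp]
  refine Finset.sum_congr rfl fun y _ => ?_
  have : H.Adj (φ x) (φ y) ↔ G.Adj x y := φ.map_adj_iff
  simp [this]

theorem sum_neighborFinset_bipartiteDoubleCover_inl {M : Type*} [AddCommMonoid M] (x : V)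
    (F : V ⊕ V → M) :
    ∑ y ∈ G.bipartiteDoubleCover.neighborFinset (Sum.inl x), F y =
      ∑ y ∈ G.neighborFinset x, F (Sum.inr y) := by
  simp_rw [sum_neighborFinset_eq_sum_ite]
  simp

theorem sum_neighborFinset_bipartiteDoubleCover_inr {M : Type*} [AddCommMonoid M] (x : V)
    (F : V ⊕ V → M) :
    ∑ y ∈ G.bipartiteDoubleCover.neighborFinset (Sum.inr x), F y =
      ∑ y ∈ G.neighborFinset x, F (Sum.inl y) := by
  simp_rw [sum_neighborFinset_eq_sum_ite]
  simp

theorem degree_bipartiteDoubleCover (x : V ⊕ V) :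
    G.bipartiteDoubleCover.degree x = G.degree (x.elim id id) := by
  simp_rw [← SimpleGraph.card_neighborFinset_eq_degree, Finset.card_eq_sum_ones]
  cases x with
  | inl x => exact sum_neighborFinset_bipartiteDoubleCover_inl x _
  | inr x => exact sum_neighborFinset_bipartiteDoubleCover_inr x _

theorem sum_sum_neighborFinset_sub_eq_zero (f : V → ℝ) :
    ∑ x, ∑ y ∈ G.neighborFinset x, (f x - f y) = 0 := by
  have h := sum_sum_neighborFinset_comm (G := G) fun x y => f x - f y
  have h' : ∑ x, ∑ y ∈ G.neighborFinset x, (f y - f x) =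
      -∑ x, ∑ y ∈ G.neighborFinset x, (f x - f y) := by
    simp_rw [← Finset.sum_neg_distrib, neg_sub]
  linarith

variable [DecidableEq V]

/-- A function whose net outflow vanishes everywhere is constant along edges. -/
theorem eq_of_adj_of_sum_sub_eq_zero {f : V → ℝ}
    (hf : ∀ x, ∑ y ∈ G.neighborFinset x, (f x - f y) = 0) {x y : V} (h : G.Adj x y) :
    f x = f y := by
  refine (G.lapMatrix_mulVec_eq_zero_iff_forall_adj (x := f)).1 ?_ x y h
  ext z
  rw [SimpleGraph.lapMatrix_mulVec_apply, Pi.zero_apply, ← hf z, Finset.sum_sub_distrib]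
  simp

/-- The potential difference across an edge does not depend on the potential. -/
theorem IsUnitCurrentPotential.sub_eq_sub {a b x y : V} {f g : V → ℝ}
    (hf : IsUnitCurrentPotential G a b f) (hg : IsUnitCurrentPotential G a b g)
    (h : G.Adj x y) : f x - f y = g x - g y := by
  have := eq_of_adj_of_sum_sub_eq_zero (G := G) (f := fun z => f z - g z) (fun z => by
    have h1 := hf z
    have h2 := hg z
    simp only [Finset.sum_sub_distrib] at h1 h2 ⊢
    linarith) h
  linarith

/-- A single potential decides the resistance even in a disconnected network, because adjacent
vertices lie in one component. The double graph of a bipartite graph needs this generality. -/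
theorem IsUnitCurrentPotential.hasResistanceDistance {a b : V} {f : V → ℝ}
    (hf : IsUnitCurrentPotential G a b f) (h : G.Adj a b) {r : ℝ} (hr : f a - f b = r) :
    HasResistanceDistance G a b r :=
  ⟨⟨f, hf⟩, fun _ hg => (hg.sub_eq_sub hf h).trans hr⟩

theorem HasResistanceDistance.symm {a b : V} {r : ℝ} (hr : HasResistanceDistance G a b r)
    (h : G.Adj a b) : HasResistanceDistance G b a r := by
  obtain ⟨f, hf⟩ := hr.1
  have hneg : IsUnitCurrentPotential G b a fun x => -f x := fun x => by
    rw [← neg_sub (if x = a then (1 : ℝ) else 0), ← hf x, ← Finset.sum_neg_distrib]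
    exact Finset.sum_congr rfl fun y _ => by ring
  exact hneg.hasResistanceDistance h.symm (by rw [← hr.2 f hf]; ring)

theorem HasResistanceDistance.map {W : Type*} [Fintype W] [DecidableEq W] {H : SimpleGraph W}
    [DecidableRel H.Adj] (φ : G ≃g H) {a b : V} {r : ℝ} (hr : HasResistanceDistance G a b r)
    (h : G.Adj a b) : HasResistanceDistance H (φ a) (φ b) r := by
  obtain ⟨f, hf⟩ := hr.1
  have hmap : IsUnitCurrentPotential H (φ a) (φ b) fun x => f (φ.symm x) := fun x => by
    obtain ⟨x, rfl⟩ := φ.surjective x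
    rw [sum_neighborFinset_iso φ]
    simpa using hf x
  exact hmap.hasResistanceDistance (φ.map_adj_iff.2 h) (by simpa using hr.2 f hf)

/-- If only constants are constant along edges, then a unit current injected at `x` can be
extracted uniformly. -/
theorem exists_sum_sub_eq_single_sub [Nonempty V]
    (hker : ∀ f : V → ℝ, (∀ x y, G.Adj x y → f x = f y) → ∀ x y, f x = f y) (a : V) :
    ∃ g : V → ℝ, ∀ x, ∑ y ∈ G.neighborFinset x, (g x - g y) =
      (if x = a then (1 : ℝ) else 0) - 1 / Fintype.card V := by
  -- The Laplacian plus the total sum: the extra term removes the constants from the kernel, so `T`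
  -- is invertible.
  let T : (V → ℝ) →ₗ[ℝ] (V → ℝ) :=
    { toFun := fun f x => ∑ y ∈ G.neighborFinset x, (f x - f y) + ∑ z, f z
      map_add' := fun f g => by
        ext x
        simp only [Pi.add_apply, Finset.sum_add_distrib, Finset.sum_sub_distrib]
        ring
      map_smul' := fun c f => by
        ext x
        simp only [Pi.smul_apply, smul_eq_mul, RingHom.id_apply, ← mul_sub, ← Finset.mul_sum]
        ring }
  have hN : (Fintype.card V : ℝ) ≠ 0 := by
    exact_mod_cast Fintype.card_ne_zero
  have hsum : ∀ f : V → ℝ, ∑ x, T f x = Fintype.card V * ∑ z, f z := fun f => by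
    change ∑ x, (∑ y ∈ G.neighborFinset x, (f x - f y) + ∑ z, f z) = _
    rw [Finset.sum_add_distrib, sum_sum_neighborFinset_sub_eq_zero]
    simp
  have hinj : Function.Injective T := by
    rw [injective_iff_map_eq_zero]
    intro f hf
    have h0 : ∑ z, f z = 0 := by
      have := hsum f
      rw [hf] at this
      simpa [hN] using this.symm
    have hconst := hker f fun x y h => eq_of_adj_of_sum_sub_eq_zero (G := G) (fun x => by
      have h1 : T f x = 0 := by rw [hf]; rfl
      change ∑ y ∈ G.neighborFinset x, (f x - f y) + ∑ z, f z = 0 at h1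
      rwa [h0, add_zero] at h1) h
    ext x
    have h2 : ∑ z, f z = Fintype.card V * f x := by
      rw [Finset.sum_congr rfl fun z _ => hconst z x]
      simp
    rw [h0] at h2
    simpa [hN] using h2.symm
  obtain ⟨g, hg⟩ := LinearMap.injective_iff_surjective.1 hinj (Pi.single a 1)
  -- The total of the solution is exactly the uniform sink of the statement.
  have hg1 : ∑ z, g z = 1 / Fintype.card V := by
    have := hsum g
    rw [hg, Finset.sum_pi_single'] at this
    rw [eq_div_iff hN, mul_comm, ← this]
    simp
  refine ⟨g, fun x => ?_⟩
  have h1 : ∑ y ∈ G.neighborFinset x, (g x - g y) + ∑ z, g z = (Pi.single a 1 : V → ℝ) x :=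
    congrFun hg x
  rw [Pi.single_apply] at h1
  linarith

/-- **Foster's theorem** for a network in which all edges have the same effective resistance. -/
theorem exists_hasResistanceDistance_of_forall_adj [Nonempty V]
    (hker : ∀ f : V → ℝ, (∀ x y, G.Adj x y → f x = f y) → ∀ x y, f x = f y)
    (hsymm : ∀ a b x y, G.Adj a b → G.Adj x y → ∀ r, HasResistanceDistance G a b r →
      HasResistanceDistance G x y r) {a b : V} (h : G.Adj a b) :
    ∃ r : ℝ, HasResistanceDistance G a b r ∧
      (∑ x, G.degree x : ℕ) * r = 2 * ((Fintype.card V : ℝ) - 1) := by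
  choose g hg using exists_sum_sub_eq_single_sub (G := G) hker
  -- `g x` has a unit source at `x` and a uniform sink; in the difference the two sinks cancel.
  have hpot : ∀ x y, IsUnitCurrentPotential G x y fun z => g x z - g y z := fun x y z => by
    have h1 := hg x z
    have h2 := hg y z
    simp only [Finset.sum_sub_distrib] at h1 h2 ⊢
    linarith
  have hres := (hpot a b).hasResistanceDistance h rfl
  refine ⟨_, hres, ?_⟩
  set r := (g a a - g b a) - (g a b - g b b) with hr
  have hall : ∀ x, ∀ y ∈ G.neighborFinset x, r = (g x x - g x y) + (g y y - g y x) := by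
    intro x y hxy
    have hadj := (G.mem_neighborFinset x y).1 hxy
    have := (hsymm a b x y h hadj r hres).2 _ (hpot x y)
    linarith
  have hN : (Fintype.card V : ℝ) ≠ 0 := by
    exact_mod_cast Fintype.card_ne_zero
  -- The sum runs over oriented edges. By reversal both halves of each resistance contribute
  -- equally, and the inner sum is the outflow of `g x` at `x`, namely one minus the uniform sink.
  calc ((∑ x, G.degree x : ℕ) : ℝ) * r = ∑ x, ∑ y ∈ G.neighborFinset x, r := by
        simp [Finset.sum_mul]
    _ = ∑ x, ∑ y ∈ G.neighborFinset x, ((g x x - g x y) + (g y y - g y x)) :=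
        Finset.sum_congr rfl fun x _ => Finset.sum_congr rfl (hall x)
    _ = 2 * ∑ x, ∑ y ∈ G.neighborFinset x, (g x x - g x y) := by
        simp_rw [Finset.sum_add_distrib]
        rw [← sum_sum_neighborFinset_comm fun x y => g x x - g x y]
        ring
    _ = 2 * ((Fintype.card V : ℝ) - 1) := by
        simp_rw [hg, if_true]
        simp [mul_sub, hN]

theorem HasResistanceDistance.of_isEdgeTransitive (hG : IsEdgeTransitive G) {a b x y : V}
    (h : G.Adj a b) (h' : G.Adj x y) {r : ℝ} (hr : HasResistanceDistance G a b r) :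
    HasResistanceDistance G x y r := by
  obtain ⟨φ, hφ⟩ := hG s(a, b) h s(x, y) h'
  have hmap := hr.map φ h
  rw [Sym2.map_mk, Sym2.eq_iff] at hφ
  -- The automorphism may reverse the edge; symmetry of the resistance covers that case.
  rcases hφ with ⟨h1, h2⟩ | ⟨h1, h2⟩
  · rwa [h1, h2] at hmap
  · rw [h1, h2] at hmap
    exact hmap.symm h'.symm

theorem eq_of_connected_of_forall_adj {V α : Type*} {G : SimpleGraph V} (hG : G.Connected)
    {f : V → α} (hf : ∀ x y, G.Adj x y → f x = f y) (x y : V) : f x = f y := by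
  obtain ⟨w⟩ := hG.preconnected x y
  induction w with
  | nil => rfl
  | cons h _ ih => exact (hf _ _ h).trans ih

theorem hasResistanceDistance_of_isEdgeTransitive (hG : G.Connected) {d : ℕ}
    (hd : G.IsRegularOfDegree d) (ht : IsEdgeTransitive G) {a b : V} (h : G.Adj a b) :
    HasResistanceDistance G a b (((Fintype.card V : ℝ) - 1) / (d * Fintype.card V / 2)) := by
  have := hG.nonempty
  obtain ⟨r, hr, hsum⟩ := exists_hasResistanceDistance_of_forall_adj (G := G)
    (fun f hf => eq_of_connected_of_forall_adj hG hf)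
    (fun a b x y h h' r hr => hr.of_isEdgeTransitive ht h h') h
  have hd0 : (d : ℝ) ≠ 0 := by
    have : 0 < G.degree a := (G.degree_pos_iff_exists_adj a).2 ⟨b, h⟩
    rw [hd a] at this
    exact_mod_cast this.ne'
  have hN : (Fintype.card V : ℝ) ≠ 0 := by
    exact_mod_cast Fintype.card_ne_zero
  convert hr
  rw [Finset.sum_congr rfl fun x _ => hd x] at hsum
  simp only [Finset.sum_const, Finset.card_univ, smul_eq_mul, Nat.cast_mul] at hsum
  field_simp
  linarith

/-! ### The bipartite double graph -/

/-- An automorphism of `G` acts on the bipartite double graph. -/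
def bipartiteDoubleCoverIso {V : Type*} {G : SimpleGraph V} (φ : G ≃g G) :
    G.bipartiteDoubleCover ≃g G.bipartiteDoubleCover where
  toEquiv := Equiv.sumCongr φ.toEquiv φ.toEquiv
  map_rel_iff' {x y} := by
    rcases x with x | x <;> rcases y with y | y <;> simp [φ.map_adj_iff]

/-- The automorphism of the bipartite double graph that exchanges the two copies. -/
def bipartiteDoubleCoverSwap {V : Type*} (G : SimpleGraph V) :
    G.bipartiteDoubleCover ≃g G.bipartiteDoubleCover where
  toEquiv := Equiv.sumComm V V
  map_rel_iff' {x y} := by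
    rcases x with x | x <;> rcases y with y | y <;> simp

theorem IsEdgeTransitive.bipartiteDoubleCover {V : Type*} {G : SimpleGraph V}
    (hG : IsEdgeTransitive G) : IsEdgeTransitive G.bipartiteDoubleCover := by
  have key : ∀ e ∈ G.bipartiteDoubleCover.edgeSet, ∃ a b, G.Adj a b ∧
      e = s(Sum.inl a, Sum.inr b) := by
    intro e he
    induction e with | _ x y
    rw [SimpleGraph.mem_edgeSet] at he
    rcases x with x | x <;> rcases y with y | y <;> simp at he
    · exact ⟨x, y, he, rfl⟩
    · exact ⟨y, x, he.symm, Sym2.eq_swap⟩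
  intro e he e' he'
  obtain ⟨a, b, h, rfl⟩ := key e he
  obtain ⟨x, y, h', rfl⟩ := key e' he'
  obtain ⟨φ, hφ⟩ := hG s(a, b) h s(x, y) h'
  rw [Sym2.map_mk, Sym2.eq_iff] at hφ
  -- If the automorphism reverses the edge, exchanging the two copies restores the out-to-in form.
  rcases hφ with ⟨h1, h2⟩ | ⟨h1, h2⟩
  · refine ⟨bipartiteDoubleCoverIso φ, ?_⟩
    change s(Sum.inl (φ a), Sum.inr (φ b)) = _
    rw [h1, h2]
  · refine ⟨(bipartiteDoubleCoverIso φ).trans (bipartiteDoubleCoverSwap G), ?_⟩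
    change s(Sum.inr (φ a), Sum.inl (φ b)) = _
    rw [h1, h2, Sym2.eq_swap]

/-- On the double graph of a connected graph that is not bipartite, only constants are constant
along edges. -/
theorem bipartiteDoubleCover_eq_of_forall_adj {V : Type*} {G : SimpleGraph V}
    (hG : G.Connected) (hb : ¬ G.IsBipartite)
    (f : V ⊕ V → ℝ) (hf : ∀ x y, G.bipartiteDoubleCover.Adj x y → f x = f y) (x y : V ⊕ V) :
    f x = f y := by
  have hadj : ∀ u v, G.Adj u v → f (Sum.inl u) = f (Sum.inr v) := fun u v h =>
    hf _ _ (by simpa using h)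
  -- The difference between the two copies changes sign along every edge, so its absolute value is
  -- constant. Were it nonzero, its sign would be a 2-colouring of `G`.
  have hdiff : ∀ u, f (Sum.inl u) = f (Sum.inr u) := by
    by_contra! hne
    obtain ⟨u, hu⟩ := hne
    have habs := eq_of_connected_of_forall_adj hG
      (f := fun v => |f (Sum.inl v) - f (Sum.inr v)|) (fun v w h => by
        rw [hadj v w h, ← hadj w v h.symm, abs_sub_comm])
    have hne : ∀ v, f (Sum.inl v) ≠ f (Sum.inr v) := fun v hv => hu <| by
      have := habs v u
      simp only [hv, sub_self, abs_zero] at this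
      exact sub_eq_zero.1 (abs_eq_zero.1 this.symm)
    have hcol : G.Coloring Prop := SimpleGraph.Coloring.mk
      (fun v => f (Sum.inl v) < f (Sum.inr v)) (fun {v w} h heq => by
        have heq' := iff_of_eq heq
        rw [hadj v w h, ← hadj w v h.symm] at heq'
        rcases lt_or_gt_of_ne (hne w) with h1 | h1
        · exact absurd (heq'.2 h1) h1.not_gt
        · exact absurd (heq'.1 h1) h1.not_gt)
    exact hb (by simpa using hcol.colorable)
  have hinl := eq_of_connected_of_forall_adj hG (f := fun v => f (Sum.inl v))
    (fun v w h => (hadj v w h).trans (hdiff w).symm)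
  have hinl' : ∀ z : V ⊕ V, f z = f (Sum.inl (z.elim id id)) := by
    rintro (z | z)
    · rfl
    · exact (hdiff z).symm
  rw [hinl' x, hinl' y]
  exact hinl _ _

theorem hasResistanceDistance_bipartiteDoubleCover_of_not_isBipartite (hG : G.Connected) {d : ℕ}
    (hd : G.IsRegularOfDegree d) (ht : IsEdgeTransitive G) (hb : ¬ G.IsBipartite) {a b : V}
    (h : G.Adj a b) :
    HasResistanceDistance G.bipartiteDoubleCover (Sum.inl a) (Sum.inr b)
      ((2 * (Fintype.card V : ℝ) - 1) / (d * Fintype.card V)) := by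
  have := hG.nonempty
  obtain ⟨r, hr, hsum⟩ := exists_hasResistanceDistance_of_forall_adj (G := G.bipartiteDoubleCover)
    (bipartiteDoubleCover_eq_of_forall_adj hG hb)
    (fun a b x y h h' r hr => hr.of_isEdgeTransitive ht.bipartiteDoubleCover h h')
    (a := Sum.inl a) (b := Sum.inr b) (by simpa using h)
  have hd0 : (d : ℝ) ≠ 0 := by
    have : 0 < G.degree a := (G.degree_pos_iff_exists_adj a).2 ⟨b, h⟩
    rw [hd a] at this
    exact_mod_cast this.ne'
  have hN : (Fintype.card V : ℝ) ≠ 0 := by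
    exact_mod_cast Fintype.card_ne_zero
  convert hr
  rw [Finset.sum_congr rfl fun x _ => (degree_bipartiteDoubleCover x).trans (hd _)] at hsum
  simp only [Finset.sum_const, Finset.card_univ, smul_eq_mul, Nat.cast_mul, Fintype.card_sum,
    Nat.cast_add] at hsum
  field_simp
  linarith

/-- In a bipartite graph the double graph is two copies of the graph. -/
theorem HasResistanceDistance.bipartiteDoubleCover (hb : G.IsBipartite) {a b : V}
    (h : G.Adj a b) {r : ℝ} (hr : HasResistanceDistance G a b r) :
    HasResistanceDistance G.bipartiteDoubleCover (Sum.inl a) (Sum.inr b) r := by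
  obtain ⟨c⟩ := hb
  obtain ⟨f, hf⟩ := hr.1
  have hc : ∀ x y, G.Adj x y → (c x = c a ↔ c y ≠ c a) := fun x y hxy => by
    have := c.valid hxy
    lia
  -- The copy of `G` through `a_out` has the colour of `a` on the out side and the other colour on
  -- the in side. The potential is `f` there and zero on the other copy.
  have hpot : IsUnitCurrentPotential G.bipartiteDoubleCover (Sum.inl a) (Sum.inr b)
      (Sum.elim (fun x => if c x = c a then f x else 0) fun x => if c x ≠ c a then f x else 0) := by
    rintro (x | x)
    · rw [sum_neighborFinset_bipartiteDoubleCover_inl]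
      by_cases hx : c x = c a
      · have hxb : x ≠ b := by
          rintro rfl
          exact (hc a x h).1 rfl hx
        have h1 := hf x
        rw [if_neg hxb] at h1
        simp only [Sum.elim_inl, Sum.elim_inr, if_pos hx, Sum.inl.injEq, reduceCtorEq, if_false]
        rw [← h1]
        refine Finset.sum_congr rfl fun y hy => ?_
        rw [if_pos ((hc x y ((G.mem_neighborFinset x y).1 hy)).1 hx)]
      · have hxa : x ≠ a := by
          rintro rfl
          exact hx rfl
        simp only [Sum.elim_inl, Sum.elim_inr, if_neg hx, Sum.inl.injEq, reduceCtorEq, if_false,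
          if_neg hxa, sub_zero]
        refine Finset.sum_eq_zero fun y hy => ?_
        rw [if_neg (mt (hc x y ((G.mem_neighborFinset x y).1 hy)).2 hx), sub_zero]
    · rw [sum_neighborFinset_bipartiteDoubleCover_inr]
      by_cases hx : c x = c a
      · have hxb : x ≠ b := by
          rintro rfl
          exact (hc a x h).1 rfl hx
        simp only [Sum.elim_inl, Sum.elim_inr, if_neg (not_not.2 hx), Sum.inr.injEq, reduceCtorEq,
          if_false, if_neg hxb, sub_zero]
        refine Finset.sum_eq_zero fun y hy => ?_
        rw [if_neg ((hc x y ((G.mem_neighborFinset x y).1 hy)).1 hx), sub_zero]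
      · have hxa : x ≠ a := by
          rintro rfl
          exact hx rfl
        have h1 := hf x
        rw [if_neg hxa] at h1
        simp only [Sum.elim_inl, Sum.elim_inr, if_pos (show c x ≠ c a from hx), Sum.inr.injEq,
          reduceCtorEq, if_false]
        rw [← h1]
        refine Finset.sum_congr rfl fun y hy => ?_
        rw [if_pos ((hc y x ((G.mem_neighborFinset x y).1 hy).symm).2 hx)]
  refine hpot.hasResistanceDistance (by simpa using h) ?_
  simp only [Sum.elim_inl, Sum.elim_inr, if_true]
  rw [if_pos ((hc a b h).1 rfl), hr.2 f hf]

end Resistance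

/-! ### Flip states -/

noncomputable section

section FlipStates

variable {V : Type*} [Fintype V] [DecidableEq V] {G : SimpleGraph V} [DecidableRel G.Adj]

theorem sum_dart_symm {V M : Type*} [Fintype V] {G : SimpleGraph V} [DecidableRel G.Adj]
    [AddCommMonoid M] (F : G.Dart → M) :
    ∑ e : G.Dart, F e.symm = ∑ e, F e :=
  Equiv.sum_comp (SimpleGraph.Dart.symm_involutive (G := G)).toPerm F

theorem sum_dart_snd_eq {M : Type*} [AddCommMonoid M] (F : G.Dart → M) (u : V) :
    ∑ e : G.Dart with e.snd = u, F e = ∑ e : G.Dart with e.fst = u, F e.symm := by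
  rw [Finset.sum_filter, Finset.sum_filter, ← sum_dart_symm]
  rfl

theorem sum_dart_fst_eq {M : Type*} [AddCommMonoid M] (F : V → M) (u : V) :
    ∑ e : G.Dart with e.fst = u, F e.snd = ∑ v ∈ G.neighborFinset u, F v := by
  refine Finset.sum_bij (fun e _ => e.snd) ?_ ?_ ?_ fun _ _ => rfl
  · intro e he
    rw [G.mem_neighborFinset, ← (Finset.mem_filter.1 he).2]
    exact e.adj
  · intro e he e' he' h
    refine SimpleGraph.Dart.ext _ _ (Prod.ext ?_ h)
    exact (Finset.mem_filter.1 he).2.trans (Finset.mem_filter.1 he').2.symm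
  · intro v hv
    exact ⟨⟨(u, v), (G.mem_neighborFinset u v).1 hv⟩, by simp, rfl⟩

/-- At an isolated vertex the factor `1 / 0` is zero, but the sum is empty, so nothing is lost. -/
theorem one_div_degree_mul_sum_dart_eq_zero_iff (F : G.Dart → ℂ) (u : V) :
    1 / (G.degree u : ℂ) * ∑ e : G.Dart with e.fst = u, F e = 0 ↔
      ∑ e : G.Dart with e.fst = u, F e = 0 := by
  refine ⟨fun h => ?_, fun h => by rw [h, mul_zero]⟩
  by_cases hu : G.degree u = 0
  · rw [← G.dart_fst_fiber_card_eq_degree, Finset.card_eq_zero] at hu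
    rw [hu, Finset.sum_empty]
  · simpa [hu] using h

theorem mem_flipStates_iff {ψ : WalkSpace G} :
    ψ ∈ flipStates G ↔ ∀ u, ∑ e : G.Dart with e.fst = u, ψ e = 0 ∧
      ∑ e : G.Dart with e.fst = u, ψ e.symm = 0 := by
  change (∀ u, avgOut G ψ u = 0 ∧ avgIn G ψ u = 0) ↔ _
  refine forall_congr' fun u => ?_
  rw [avgOut, avgIn, sum_dart_snd_eq, one_div_degree_mul_sum_dart_eq_zero_iff,
    one_div_degree_mul_sum_dart_eq_zero_iff fun e => ψ e.symm]

theorem inner_ket {a b : V} (h : G.Adj a b) (ψ : WalkSpace G) :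
    ⟪ket G h, ψ⟫_ℂ = ψ ⟨(a, b), h⟩ := by
  simp [ket, EuclideanSpace.inner_single_left]

theorem ket_apply {a b : V} (h : G.Adj a b) (e : G.Dart) :
    ket G h e = if e = ⟨(a, b), h⟩ then 1 else 0 := by
  simp [ket, PiLp.single_apply]

theorem sum_dart_fst_ket {a b : V} (h : G.Adj a b) (u : V) :
    ∑ e : G.Dart with e.fst = u, ket G h e = if u = a then 1 else 0 := by
  simp only [ket_apply, Finset.sum_ite_eq', Finset.mem_filter, Finset.mem_univ, true_and]
  exact if_congr eq_comm rfl rfl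

theorem ket_symm_apply {a b : V} (h : G.Adj a b) (e : G.Dart) :
    ket G h.symm e = ket G h e.symm := by
  rw [ket_apply, ket_apply]
  refine if_congr ⟨?_, fun he => ?_⟩ rfl rfl
  · rintro rfl
    rfl
  · rw [← e.symm_symm, he]
    rfl

theorem sum_dart_fst_ket_symm {a b : V} (h : G.Adj a b) (u : V) :
    ∑ e : G.Dart with e.fst = u, ket G h e.symm = if u = b then 1 else 0 := by
  simp_rw [← ket_symm_apply h]
  exact sum_dart_fst_ket h.symm u

/-- The dart vector `e ↦ f (e.fst) - g (e.snd)`: the currents of a potential on the bipartite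
double graph. -/
def potentialDrop {V : Type*} [Fintype V] (G : SimpleGraph V) [DecidableRel G.Adj]
    (f g : V → ℝ) : WalkSpace G :=
  WithLp.toLp 2 fun e : G.Dart => ((f e.fst - g e.snd : ℝ) : ℂ)

theorem sum_dart_fst_potentialDrop (f g : V → ℝ) (u : V) :
    ∑ e : G.Dart with e.fst = u, potentialDrop G f g e =
      ((∑ v ∈ G.neighborFinset u, (f u - g v) : ℝ) : ℂ) := by
  rw [← sum_dart_fst_eq (fun v => f u - g v), Complex.ofReal_sum]
  refine Finset.sum_congr rfl fun e he => ?_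
  rw [← (Finset.mem_filter.1 he).2]
  rfl

theorem potentialDrop_symm_apply {V : Type*} [Fintype V] {G : SimpleGraph V} [DecidableRel G.Adj]
    (f g : V → ℝ) (e : G.Dart) :
    potentialDrop G f g e.symm = -potentialDrop G g f e := by
  simp [potentialDrop]

/-- Grouped by vertices, `f` multiplies the outgoing sums of a flip state and `g` its incoming sums;
both vanish. -/
theorem potentialDrop_mem_orthogonal (f g : V → ℝ) :
    potentialDrop G f g ∈ (flipStates G)ᗮ := by
  rw [Submodule.mem_orthogonal']
  intro φ hφ
  rw [mem_flipStates_iff] at hφ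
  have h1 : ∑ e, (f e.fst : ℂ) * φ e = 0 := by
    rw [← Finset.sum_fiberwise Finset.univ fun e : G.Dart => e.fst]
    refine Finset.sum_eq_zero fun u _ => ?_
    rw [Finset.sum_congr rfl fun e he => by rw [(Finset.mem_filter.1 he).2],
      ← Finset.mul_sum, (hφ u).1, mul_zero]
  have h2 : ∑ e : G.Dart, (g e.fst : ℂ) * φ e.symm = 0 := by
    rw [← Finset.sum_fiberwise Finset.univ fun e : G.Dart => e.fst]
    refine Finset.sum_eq_zero fun u _ => ?_
    rw [Finset.sum_congr rfl fun e he => by rw [(Finset.mem_filter.1 he).2],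
      ← Finset.mul_sum, (hφ u).2, mul_zero]
  have h3 : ∑ e : G.Dart, (g e.snd : ℂ) * φ e = 0 := by
    rw [← h2, ← sum_dart_symm]
    rfl
  rw [PiLp.inner_apply]
  calc ∑ e, ⟪potentialDrop G f g e, φ e⟫_ℂ
      = ∑ e, ((f e.fst : ℂ) * φ e - (g e.snd : ℂ) * φ e) := by
        refine Finset.sum_congr rfl fun e _ => ?_
        simp [potentialDrop]
        ring
    _ = 0 := by rw [Finset.sum_sub_distrib, h1, h3, sub_zero]

theorem starProjection_flipStates_eq {ψ : WalkSpace G} {f g : V → ℝ}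
    (h : ψ - potentialDrop G f g ∈ flipStates G) :
    (flipStates G).starProjection ψ = ψ - potentialDrop G f g :=
  Submodule.eq_starProjection_of_mem_orthogonal h
    (by rw [sub_sub_cancel]; exact potentialDrop_mem_orthogonal f g)

/-- In this form the weight of a basis state is a single entry of its projection. -/
theorem flipWeight_eq_re_inner (ψ : WalkSpace G) :
    flipWeight G ψ = (⟪ψ, (flipStates G).starProjection ψ⟫_ℂ).re := by
  rw [← inner_conj_symm, Complex.conj_re]
  exact (Submodule.re_inner_starProjection_eq_normSq (K := flipStates G) ψ).symm

/-- The unit current from `a_out` to `b_in` has the same outgoing and incoming sums as `|ab⟩`, so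
their difference is a flip state, with entry `1 - r` at `ab`. -/
theorem flipWeight_ket {a b : V} (h : G.Adj a b) {r : ℝ}
    (hr : HasResistanceDistance G.bipartiteDoubleCover (Sum.inl a) (Sum.inr b) r) :
    flipWeight G (ket G h) = 1 - r := by
  obtain ⟨f, hf⟩ := hr.1
  have hmem : ket G h - potentialDrop G (fun u => f (Sum.inl u)) (fun u => f (Sum.inr u)) ∈
      flipStates G := by
    rw [mem_flipStates_iff]
    intro u
    simp only [PiLp.sub_apply, Finset.sum_sub_distrib, potentialDrop_symm_apply,
      Finset.sum_neg_distrib, sum_dart_fst_potentialDrop, sum_dart_fst_ket, sum_dart_fst_ket_symm]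
    have h1 := hf (Sum.inl u)
    have h2 := hf (Sum.inr u)
    rw [sum_neighborFinset_bipartiteDoubleCover_inl] at h1
    rw [sum_neighborFinset_bipartiteDoubleCover_inr] at h2
    rw [← Finset.sum_sub_distrib, ← Finset.sum_sub_distrib, h1, h2]
    constructor <;> simp <;> split_ifs <;> simp
  rw [flipWeight_eq_re_inner, starProjection_flipStates_eq hmem, inner_ket, PiLp.sub_apply,
    ket_apply, if_pos rfl, ← hr.2 f hf]
  simp [potentialDrop]

theorem flipWeight_edgeState {a b : V} (h : G.Adj a b) {r : ℝ}
    (hr : HasResistanceDistance G a b r) : flipWeight G (edgeState G h) = 1 - r := by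
  obtain ⟨f, hf⟩ := hr.1
  have hmem : ket G h - ket G h.symm - potentialDrop G f f ∈ flipStates G := by
    rw [mem_flipStates_iff]
    intro u
    simp only [PiLp.sub_apply, Finset.sum_sub_distrib, potentialDrop_symm_apply,
      Finset.sum_neg_distrib, sum_dart_fst_potentialDrop, sum_dart_fst_ket, sum_dart_fst_ket_symm]
    rw [← Finset.sum_sub_distrib, hf u]
    constructor <;> simp <;> split_ifs <;> simp
  have hne : (⟨(a, b), h⟩ : G.Dart) ≠ ⟨(b, a), h.symm⟩ := fun he =>
    h.ne (congrArg (fun e : G.Dart => e.fst) he)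
  -- The entries at `ab` and `ba` contribute `1 - r` each; the normalization `1 / √2` halves the
  -- total.
  have hw : flipWeight G (ket G h - ket G h.symm) = 2 * (1 - r) := by
    rw [flipWeight_eq_re_inner, starProjection_flipStates_eq hmem, inner_sub_left, inner_ket,
      inner_ket]
    simp only [PiLp.sub_apply, ket_apply, if_true, if_neg hne, if_neg hne.symm, ← hr.2 f hf,
      potentialDrop]
    simp
    ring
  rw [flipWeight] at hw
  rw [flipWeight, edgeState, map_smul, norm_smul, mul_pow, hw]
  simp

end FlipStates

end

/-! ### Dynamics of the walk -/

section Walk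

variable {V : Type*} [Fintype V] {G : SimpleGraph V} [DecidableRel G.Adj]

theorem flipFlopShift_apply (ψ : WalkSpace G) (e : G.Dart) :
    flipFlopShift G ψ e = ψ e.symm := rfl

theorem flipFlopShift_flipFlopShift (ψ : WalkSpace G) :
    flipFlopShift G (flipFlopShift G ψ) = ψ := by
  ext e
  simp [flipFlopShift_apply]

theorem inner_flipFlopShift_left (ψ χ : WalkSpace G) :
    ⟪flipFlopShift G ψ, χ⟫_ℂ = ⟪ψ, flipFlopShift G χ⟫_ℂ := by
  rw [PiLp.inner_apply, PiLp.inner_apply, ← sum_dart_symm]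
  simp [flipFlopShift_apply]

variable [DecidableEq V]

theorem flipFlopShift_ket {a b : V} (h : G.Adj a b) :
    flipFlopShift G (ket G h) = ket G h.symm := by
  ext e
  rw [flipFlopShift_apply, ket_symm_apply h]

theorem groverCoin_apply (ψ : WalkSpace G) (e : G.Dart) :
    groverCoin G ψ e = 2 * avgOut G ψ e.fst - ψ e := by
  have hinner : ∀ u, ⟪coinState G u, ψ⟫_ℂ =
      ((1 / √(G.degree u : ℝ) : ℝ) : ℂ) * ∑ e : G.Dart with e.fst = u, ψ e := fun u => by
    rw [PiLp.inner_apply, Finset.mul_sum, Finset.sum_filter]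
    refine Finset.sum_congr rfl fun e _ => ?_
    by_cases he : e.fst = u
    · simp [coinState, he, mul_comm]
    · simp [coinState, he]
  have hsq : ((1 / √(G.degree e.fst : ℝ) : ℝ) : ℂ) * ((1 / √(G.degree e.fst : ℝ) : ℝ) : ℂ) =
      1 / (G.degree e.fst : ℂ) := by
    rw [← Complex.ofReal_mul, div_mul_div_comm, Real.mul_self_sqrt (Nat.cast_nonneg _)]
    simp
  have hsum : (∑ u, ⟪coinState G u, ψ⟫_ℂ • coinState G u) e = avgOut G ψ e.fst := by
    rw [WithLp.ofLp_sum, Finset.sum_apply, Finset.sum_eq_single e.fst]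
    · rw [PiLp.smul_apply, hinner, smul_eq_mul, avgOut, ← hsq]
      simp only [coinState, if_true]
      ring
    · intro u _ hu
      simp [coinState, hu.symm]
    · simp
  simp only [groverCoin, sub_apply, smul_apply, sum_apply,
    InnerProductSpace.rankOne_apply, PiLp.sub_apply, PiLp.smul_apply, smul_eq_mul,
    one_apply_eq_self]
  rw [← hsum]

theorem groverCoin_groverCoin (ψ : WalkSpace G) : groverCoin G (groverCoin G ψ) = ψ := by
  ext e
  have hdeg : (G.degree e.fst : ℂ) ≠ 0 := by
    exact_mod_cast ((G.degree_pos_iff_exists_adj _).2 ⟨_, e.adj⟩).ne'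
  -- The coin reflects the amplitudes at a vertex in their average, which preserves that average.
  have havg : avgOut G (groverCoin G ψ) e.fst = avgOut G ψ e.fst := by
    rw [avgOut, Finset.sum_congr rfl fun e' he' => by
      rw [groverCoin_apply, (Finset.mem_filter.1 he').2]]
    rw [Finset.sum_sub_distrib, mul_sub, ← avgOut, Finset.sum_const,
      G.dart_fst_fiber_card_eq_degree, nsmul_eq_mul]
    field_simp
    ring
  rw [groverCoin_apply, groverCoin_apply, havg]
  ring

theorem inner_groverCoin_left (ψ χ : WalkSpace G) :
    ⟪groverCoin G ψ, χ⟫_ℂ = ⟪ψ, groverCoin G χ⟫_ℂ := by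
  simp only [groverCoin, sub_apply, smul_apply, sum_apply, one_apply_eq_self,
    InnerProductSpace.rankOne_apply, inner_sub_left, inner_sub_right, inner_smul_left,
    inner_smul_right, sum_inner, inner_sum, inner_conj_symm, map_ofNat]
  simp only [mul_comm]

/-- Shift and coin are both self-adjoint, so the adjoint of `S C` is `C S`. -/
theorem inner_walkStep_right (ψ χ : WalkSpace G) :
    ⟪ψ, walkStep G χ⟫_ℂ = ⟪groverCoin G (flipFlopShift G ψ), χ⟫_ℂ := by
  rw [inner_groverCoin_left, inner_flipFlopShift_left]
  rfl

theorem norm_walkStep (ψ : WalkSpace G) : ‖walkStep G ψ‖ = ‖ψ‖ := by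
  have h : ⟪walkStep G ψ, walkStep G ψ⟫_ℂ = ⟪ψ, ψ⟫_ℂ := by
    rw [inner_walkStep_right]
    change ⟪groverCoin G (flipFlopShift G (flipFlopShift G (groverCoin G ψ))), ψ⟫_ℂ = _
    rw [flipFlopShift_flipFlopShift, groverCoin_groverCoin]
  rw [@norm_eq_sqrt_re_inner ℂ, h, ← @norm_eq_sqrt_re_inner ℂ]

theorem norm_walkStep_pow (k : ℕ) (ψ : WalkSpace G) : ‖(walkStep G ^ k) ψ‖ = ‖ψ‖ := by
  induction k with
  | zero => rfl
  | succ k ih =>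
    rw [pow_succ', mul_apply_eq_comp, norm_walkStep, ih]

theorem flipFlopShift_mem_flipStates {ψ : WalkSpace G} (h : ψ ∈ flipStates G) :
    flipFlopShift G ψ ∈ flipStates G := by
  rw [mem_flipStates_iff] at h ⊢
  intro u
  simp only [flipFlopShift_apply, SimpleGraph.Dart.symm_symm]
  exact (h u).symm

theorem groverCoin_of_mem_flipStates {ψ : WalkSpace G} (h : ψ ∈ flipStates G) :
    groverCoin G ψ = -ψ := by
  ext e
  rw [groverCoin_apply, (h e.fst).1, mul_zero, zero_sub, PiLp.neg_apply]

theorem walkStep_of_mem_flipStates {ψ : WalkSpace G} (h : ψ ∈ flipStates G) :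
    walkStep G ψ = -flipFlopShift G ψ := by
  change flipFlopShift G (groverCoin G ψ) = _
  rw [groverCoin_of_mem_flipStates h, map_neg]

theorem walkStep_pow_two_mul_of_mem_flipStates {ψ : WalkSpace G} (h : ψ ∈ flipStates G) (t : ℕ) :
    (walkStep G ^ (2 * t)) ψ = ψ := by
  have h2 : (walkStep G ^ 2) ψ = ψ := by
    rw [pow_two]
    change walkStep G (walkStep G ψ) = ψ
    rw [walkStep_of_mem_flipStates h, map_neg,
      walkStep_of_mem_flipStates (flipFlopShift_mem_flipStates h), neg_neg,
      flipFlopShift_flipFlopShift]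
  rw [pow_mul]
  induction t with
  | zero => rfl
  | succ t ih =>
    rw [pow_succ]
    change ((walkStep G ^ 2) ^ t) ((walkStep G ^ 2) ψ) = ψ
    rw [h2, ih]

theorem walkStep_pow_two_mul_add_one_of_mem_flipStates {ψ : WalkSpace G}
    (h : ψ ∈ flipStates G) (t : ℕ) :
    (walkStep G ^ (2 * t + 1)) ψ = -flipFlopShift G ψ := by
  rw [pow_succ']
  change walkStep G ((walkStep G ^ (2 * t)) ψ) = _
  rw [walkStep_pow_two_mul_of_mem_flipStates h, walkStep_of_mem_flipStates h]

/-- The adjoint `C S` maps flip states to flip states. -/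
theorem walkStep_mem_orthogonal {ψ : WalkSpace G} (h : ψ ∈ (flipStates G)ᗮ) :
    walkStep G ψ ∈ (flipStates G)ᗮ := by
  rw [Submodule.mem_orthogonal] at h ⊢
  intro φ hφ
  have hS := flipFlopShift_mem_flipStates hφ
  rw [inner_walkStep_right, groverCoin_of_mem_flipStates hS, inner_neg_left, h _ hS, neg_zero]

theorem flipFlopShift_mem_orthogonal {ψ : WalkSpace G} (h : ψ ∈ (flipStates G)ᗮ) :
    flipFlopShift G ψ ∈ (flipStates G)ᗮ := by
  rw [Submodule.mem_orthogonal] at h ⊢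
  intro φ hφ
  rw [← inner_flipFlopShift_left, h _ (flipFlopShift_mem_flipStates hφ)]

/-- The shift preserves the flip states and their complement. At odd times this identifies the
evolved flip component of `|ab⟩` with that of `-|ba⟩`. -/
theorem starProjection_flipFlopShift (ψ : WalkSpace G) :
    (flipStates G).starProjection (flipFlopShift G ψ) =
      flipFlopShift G ((flipStates G).starProjection ψ) :=
  Submodule.eq_starProjection_of_mem_orthogonal
    (flipFlopShift_mem_flipStates (Submodule.starProjection_apply_mem _ _)) (by
      rw [← map_sub]
      exact flipFlopShift_mem_orthogonal (Submodule.sub_starProjection_mem_orthogonal _))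

/-- An isometry that maps `Kᗮ` to itself and carries the `K`-component of `ψ` to that of `ψ'`
has a large amplitude between `ψ` and `ψ'` if these components are large. -/
theorem two_mul_sub_one_le_norm_inner {E : Type*} [NormedAddCommGroup E] [InnerProductSpace ℂ E]
    (K : Submodule ℂ E) [K.HasOrthogonalProjection] {T : E →L[ℂ] E} (hT : ∀ x, ‖T x‖ = ‖x‖)
    (hK : ∀ x ∈ Kᗮ, T x ∈ Kᗮ) {ψ ψ' : E} (hψ : ‖ψ‖ = 1) (hψ' : ‖ψ'‖ = 1)
    (h : T (K.starProjection ψ) = K.starProjection ψ') :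
    2 * ‖K.starProjection ψ‖ ^ 2 - 1 ≤ ‖⟪ψ', T ψ⟫_ℂ‖ := by
  set p := K.starProjection ψ with hp
  set p' := K.starProjection ψ' with hp'
  have hq : ψ - p ∈ Kᗮ := Submodule.sub_starProjection_mem_orthogonal _
  have hq' : ψ' - p' ∈ Kᗮ := Submodule.sub_starProjection_mem_orthogonal _
  have hpK : p ∈ K := Submodule.starProjection_apply_mem _ _
  have hpK' : p' ∈ K := Submodule.starProjection_apply_mem _ _
  have hnorm : ‖p'‖ = ‖p‖ := by rw [← h, hT]
  have hpyth : ∀ {x y : E}, y ∈ K → x - y ∈ Kᗮ → ‖x‖ ^ 2 = ‖y‖ ^ 2 + ‖x - y‖ ^ 2 := by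
    intro x y hy hxy
    have := norm_add_sq_eq_norm_sq_add_norm_sq_of_inner_eq_zero y (x - y)
      (Submodule.inner_right_of_mem_orthogonal hy hxy)
    rw [add_sub_cancel] at this
    rw [pow_two, pow_two, pow_two, this]
  have h1 := hpyth hpK hq
  have h2 := hpyth hpK' hq'
  rw [hψ] at h1
  rw [hψ', hnorm] at h2
  -- The cross terms vanish because `T` keeps the remainder of `ψ` in `Kᗮ`.
  have hsplit : ⟪ψ', T ψ⟫_ℂ = ⟪p', p'⟫_ℂ + ⟪ψ' - p', T (ψ - p)⟫_ℂ := by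
    have e1 : ⟪p', T (ψ - p)⟫_ℂ = 0 := Submodule.inner_right_of_mem_orthogonal hpK' (hK _ hq)
    have e2 : ⟪ψ' - p', p'⟫_ℂ = 0 := Submodule.inner_left_of_mem_orthogonal hpK' hq'
    have e3 : T ψ = p' + T (ψ - p) := by rw [map_sub, h]; abel
    rw [inner_sub_left, sub_eq_zero] at e2
    rw [e3, inner_add_right, inner_sub_left, e1, sub_zero, e2]
  have hle : ‖⟪ψ' - p', T (ψ - p)⟫_ℂ‖ ≤ ‖ψ' - p'‖ * ‖ψ - p‖ := by
    have := norm_inner_le_norm (𝕜 := ℂ) (ψ' - p') (T (ψ - p))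
    rwa [hT] at this
  have hself : ‖⟪p', p'⟫_ℂ‖ = ‖p‖ ^ 2 := by
    rw [inner_self_eq_norm_sq_to_K, hnorm]
    simp
  have htri := norm_sub_le_norm_add ⟪p', p'⟫_ℂ ⟪ψ' - p', T (ψ - p)⟫_ℂ
  rw [hsplit]
  -- Both remainders have squared norm `1 - ‖p‖ ^ 2`, which therefore bounds the product of their
  -- norms.
  nlinarith [sq_nonneg (‖ψ' - p'‖ - ‖ψ - p‖)]

theorem walkStep_pow_mem {K : Submodule ℂ (WalkSpace G)} (hK : ∀ x ∈ K, walkStep G x ∈ K) (k : ℕ)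
    {x : WalkSpace G} (hx : x ∈ K) : (walkStep G ^ k) x ∈ K := by
  induction k with
  | zero => exact hx
  | succ k ih =>
    rw [pow_succ', mul_apply_eq_comp]
    exact hK _ ih

theorem two_mul_flipWeight_sub_one_le (k : ℕ) {ψ ψ' : WalkSpace G} (hψ : ‖ψ‖ = 1)
    (hψ' : ‖ψ'‖ = 1) (h : (walkStep G ^ k) ((flipStates G).starProjection ψ) =
      (flipStates G).starProjection ψ') :
    2 * flipWeight G ψ - 1 ≤ ‖⟪ψ', (walkStep G ^ k) ψ⟫_ℂ‖ :=
  two_mul_sub_one_le_norm_inner (flipStates G) (norm_walkStep_pow k)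
    (fun _ hx => walkStep_pow_mem (fun _ => walkStep_mem_orthogonal) k hx) hψ hψ' h

theorem norm_ket {a b : V} (h : G.Adj a b) : ‖ket G h‖ = 1 := by
  simp [ket]

theorem oscillatesBetween_ket {a b : V} (h : G.Adj a b) :
    OscillatesBetween G (2 * flipWeight G (ket G h) - 1) (ket G h) (-ket G h.symm) := by
  intro t
  have hmem : (flipStates G).starProjection (ket G h) ∈ flipStates G :=
    Submodule.starProjection_apply_mem _ _
  refine ⟨two_mul_flipWeight_sub_one_le _ (norm_ket h) (norm_ket h)
    (walkStep_pow_two_mul_of_mem_flipStates hmem t),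
    two_mul_flipWeight_sub_one_le _ (norm_ket h) (by rw [norm_neg, norm_ket]) ?_⟩
  rw [walkStep_pow_two_mul_add_one_of_mem_flipStates hmem, map_neg, ← flipFlopShift_ket h,
    starProjection_flipFlopShift]

theorem norm_edgeState {a b : V} (h : G.Adj a b) : ‖edgeState G h‖ = 1 := by
  have hne : (⟨(b, a), h.symm⟩ : G.Dart) ≠ ⟨(a, b), h⟩ := fun he =>
    h.ne (congrArg (fun e : G.Dart => e.snd) he)
  have h0 : ⟪ket G h.symm, ket G h⟫_ℂ = 0 := by
    rw [inner_ket, ket_apply, if_neg hne]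
  have hsq : ‖ket G h - ket G h.symm‖ ^ 2 = 2 := by
    rw [@norm_sub_sq ℂ, norm_ket, norm_ket, ← inner_conj_symm, h0]
    norm_num
  have hnorm : ‖ket G h - ket G h.symm‖ = √2 := by
    rw [← hsq, Real.sqrt_sq (norm_nonneg _)]
  rw [edgeState, norm_smul, hnorm, Complex.norm_real, Real.norm_of_nonneg (by positivity)]
  field_simp

/-- By this antisymmetry `-S` fixes the edge state, so its flip component is stationary at all times
and not only at even ones. -/
theorem flipFlopShift_edgeState {a b : V} (h : G.Adj a b) :
    flipFlopShift G (edgeState G h) = -edgeState G h := by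
  rw [edgeState, map_smul, map_sub, flipFlopShift_ket, flipFlopShift_ket, ← smul_neg, neg_sub]

theorem staysLocalized_edgeState {a b : V} (h : G.Adj a b) :
    StaysLocalized G (2 * flipWeight G (edgeState G h) - 1) (edgeState G h) := by
  intro t
  refine two_mul_flipWeight_sub_one_le _ (norm_edgeState h) (norm_edgeState h) ?_
  have hmem : (flipStates G).starProjection (edgeState G h) ∈ flipStates G :=
    Submodule.starProjection_apply_mem _ _
  obtain ⟨s, rfl | rfl⟩ := Nat.even_or_odd' t
  · exact walkStep_pow_two_mul_of_mem_flipStates hmem s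
  · rw [walkStep_pow_two_mul_add_one_of_mem_flipStates hmem, ← starProjection_flipFlopShift,
      flipFlopShift_edgeState, map_neg, neg_neg]

/-! ### The uniform state -/

theorem uniformState_mem_orthogonal : uniformState G ∈ (flipStates G)ᗮ := by
  -- The uniform state is the drop between a constant potential on the out copy and zero on the in
  -- copy.
  have h := potentialDrop_mem_orthogonal (G := G) (fun _ => 1 / √(Fintype.card G.Dart : ℝ)) 0
  convert h using 1
  ext e
  simp [potentialDrop, uniformState]

theorem walkStep_uniformState : walkStep G (uniformState G) = uniformState G := by
  have hcoin : groverCoin G (uniformState G) = uniformState G := by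
    ext e
    have hdeg : (G.degree e.fst : ℂ) ≠ 0 := by
      exact_mod_cast ((G.degree_pos_iff_exists_adj _).2 ⟨_, e.adj⟩).ne'
    rw [groverCoin_apply, avgOut]
    simp only [uniformState, Finset.sum_const, G.dart_fst_fiber_card_eq_degree, nsmul_eq_mul]
    field_simp
    ring
  change flipFlopShift G (groverCoin G (uniformState G)) = _
  rw [hcoin]
  rfl

theorem inner_uniformState_walkStep (ψ : WalkSpace G) :
    ⟪uniformState G, walkStep G ψ⟫_ℂ = ⟪uniformState G, ψ⟫_ℂ := by
  have hshift : flipFlopShift G (uniformState G) = uniformState G := rfl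
  have hcoin : groverCoin G (uniformState G) = uniformState G := by
    rw [← flipFlopShift_flipFlopShift (groverCoin G (uniformState G))]
    change flipFlopShift G (walkStep G (uniformState G)) = _
    rw [walkStep_uniformState, hshift]
  rw [inner_walkStep_right, hshift, hcoin]

theorem norm_uniformState {V : Type*} [Fintype V] {G : SimpleGraph V} [DecidableRel G.Adj]
    [Nonempty G.Dart] : ‖uniformState G‖ = 1 := by
  have hcard : (0 : ℝ) < Fintype.card G.Dart := by
    exact_mod_cast Fintype.card_pos
  rw [EuclideanSpace.norm_eq, Real.sqrt_eq_one]
  simp only [uniformState, Complex.norm_real, Real.norm_eq_abs, sq_abs, div_pow, one_pow,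
    Real.sq_sqrt hcard.le, Finset.sum_const, Finset.card_univ, nsmul_eq_mul]
  field_simp

/-- The weight on the flip states and on the uniform state returns at even times. -/
theorem two_mul_flipWeight_add_sub_one_le [Nonempty G.Dart] (t : ℕ) {ψ : WalkSpace G}
    (hψ : ‖ψ‖ = 1) :
    2 * (flipWeight G ψ + ‖⟪uniformState G, ψ⟫_ℂ‖ ^ 2) - 1 ≤
      ‖⟪ψ, (walkStep G ^ (2 * t)) ψ⟫_ℂ‖ := by
  set σ := uniformState G with hσ
  -- At even times `U` is the identity on both summands. At odd times it is `-S` on flip states but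
  -- `S` on `σ`, so the signs no longer agree.
  set K := flipStates G ⊔ ℂ ∙ σ with hK
  set p := (flipStates G).starProjection ψ with hp
  have hmem : p ∈ flipStates G := Submodule.starProjection_apply_mem _ _
  have hσF : σ ∈ (flipStates G)ᗮ := uniformState_mem_orthogonal
  have hσσ : ⟪σ, σ⟫_ℂ = 1 := by
    rw [inner_self_eq_norm_sq_to_K, norm_uniformState]
    simp
  have hKo : ∀ x, x ∈ Kᗮ ↔ x ∈ (flipStates G)ᗮ ∧ ⟪σ, x⟫_ℂ = 0 := fun x => by
    rw [hK, ← Submodule.inf_orthogonal, Submodule.mem_inf,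
      Submodule.mem_orthogonal_singleton_iff_inner_right]
  have hproj : K.starProjection ψ = p + ⟪σ, ψ⟫_ℂ • σ := by
    refine Submodule.eq_starProjection_of_mem_orthogonal
      (Submodule.add_mem_sup hmem (Submodule.smul_mem _ _ (Submodule.mem_span_singleton_self _)))
      ((hKo _).2 ⟨?_, ?_⟩)
    · rw [← sub_sub]
      exact Submodule.sub_mem _ (Submodule.sub_starProjection_mem_orthogonal _)
        (Submodule.smul_mem _ _ hσF)
    · rw [inner_sub_right, inner_add_right, inner_smul_right, hσσ,
        Submodule.inner_left_of_mem_orthogonal hmem hσF]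
      ring
  have hpow : (walkStep G ^ (2 * t)) σ = σ := by
    induction 2 * t with
    | zero => rfl
    | succ k ih => rw [pow_succ', mul_apply_eq_comp, ih, walkStep_uniformState]
  have hnorm : ‖K.starProjection ψ‖ ^ 2 = flipWeight G ψ + ‖⟪σ, ψ⟫_ℂ‖ ^ 2 := by
    have := norm_add_sq_eq_norm_sq_add_norm_sq_of_inner_eq_zero p (⟪σ, ψ⟫_ℂ • σ)
      (Submodule.inner_right_of_mem_orthogonal hmem (Submodule.smul_mem _ _ hσF))
    rw [hproj, pow_two, this, flipWeight, norm_smul, norm_uniformState]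
    ring
  rw [← hnorm]
  refine two_mul_sub_one_le_norm_inner K (norm_walkStep_pow (2 * t))
    (fun _ hx => walkStep_pow_mem (fun x hx => ?_) (2 * t) hx) hψ hψ ?_
  · rw [hKo] at hx ⊢
    exact ⟨walkStep_mem_orthogonal hx.1, (inner_uniformState_walkStep x).trans hx.2⟩
  · rw [hproj, map_add, map_smul, hpow, walkStep_pow_two_mul_of_mem_flipStates hmem]

theorem norm_inner_ket_uniformState_sq {a b : V} (h : G.Adj a b) :
    ‖⟪ket G h, uniformState G⟫_ℂ‖ ^ 2 = 1 / Fintype.card G.Dart := by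
  rw [inner_ket]
  simp only [uniformState, Complex.norm_real, Real.norm_eq_abs, sq_abs, div_pow, one_pow,
    Real.sq_sqrt (Nat.cast_nonneg _)]

end Walk

/-! ### Examples of edge-transitive graphs -/

theorem isEdgeTransitive_top (V : Type*) [DecidableEq V] :
    IsEdgeTransitive (⊤ : SimpleGraph V) := by
  intro e he e' he'
  induction e with | _ a b
  induction e' with | _ c d
  rw [SimpleGraph.mem_edgeSet, SimpleGraph.top_adj] at he he'
  -- The first swap sends `a` to `c`; the second sends the image of `b` to `d` without moving `c`.
  refine ⟨SimpleGraph.Iso.completeGraph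
    ((Equiv.swap a c).trans (Equiv.swap (Equiv.swap a c b) d)), ?_⟩
  change s(Equiv.swap (Equiv.swap a c b) d (Equiv.swap a c a),
    Equiv.swap (Equiv.swap a c b) d (Equiv.swap a c b)) = _
  have hne : c ≠ Equiv.swap a c b := by
    intro h
    apply he
    rw [← Equiv.swap_apply_left a c] at h
    exact (Equiv.swap a c).injective (by simpa using h)
  rw [Equiv.swap_apply_left, Equiv.swap_apply_left, Equiv.swap_apply_of_ne_of_ne hne he']

theorem connected_completeBipartiteGraph (α β : Type*) [Nonempty α] [Nonempty β] :
    (completeBipartiteGraph α β).Connected := by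
  have hadj : ∀ (a : α) (b : β), (completeBipartiteGraph α β).Reachable (Sum.inl a) (Sum.inr b) :=
    fun a b => SimpleGraph.Adj.reachable (by simp)
  obtain ⟨a⟩ := ‹Nonempty α›
  obtain ⟨b⟩ := ‹Nonempty β›
  refine (SimpleGraph.connected_iff_exists_forall_reachable _).2 ⟨Sum.inl a, ?_⟩
  rintro (x | y)
  · exact (hadj a b).trans (hadj x b).symm
  · exact hadj a y

theorem isEdgeTransitive_completeBipartiteGraph (α β : Type*) [DecidableEq α] [DecidableEq β] :
    IsEdgeTransitive (completeBipartiteGraph α β) := by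
  have key : ∀ e ∈ (completeBipartiteGraph α β).edgeSet, ∃ a b, e = s(Sum.inl a, Sum.inr b) := by
    intro e he
    induction e with | _ x y
    rw [SimpleGraph.mem_edgeSet] at he
    rcases x with x | x <;> rcases y with y | y <;> simp at he
    · exact ⟨x, y, rfl⟩
    · exact ⟨y, x, Sym2.eq_swap⟩
  intro e he e' he'
  obtain ⟨a, b, rfl⟩ := key e he
  obtain ⟨c, d, rfl⟩ := key e' he'
  refine ⟨⟨Equiv.sumCongr (Equiv.swap a c) (Equiv.swap b d), fun {x y} => ?_⟩, ?_⟩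
  · rcases x with x | x <;> rcases y with y | y <;> simp
  · change s(Sum.inl (Equiv.swap a c a), Sum.inr (Equiv.swap b d b)) = _
    rw [Equiv.swap_apply_left, Equiv.swap_apply_left]

theorem isRegularOfDegree_completeBipartiteGraph (n : ℕ) :
    (completeBipartiteGraph (Fin n) (Fin n)).IsRegularOfDegree n := by
  intro x
  rw [← SimpleGraph.card_neighborFinset_eq_degree, Finset.card_eq_sum_ones,
    sum_neighborFinset_eq_sum_ite, Fintype.sum_sum_type]
  rcases x with x | x <;> simp

/-- A graph on functions in which changing one value keeps the connected component is
connected. -/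
theorem connected_of_reachable_update {ι α : Type*} [Finite ι] [DecidableEq ι]
    [Nonempty (ι → α)] {G : SimpleGraph (ι → α)}
    (h : ∀ x i c, G.Reachable x (Function.update x i c)) : G.Connected := by
  cases nonempty_fintype ι
  refine (SimpleGraph.connected_iff _).2 ⟨fun x y => ?_, inferInstance⟩
  -- The coordinates are changed from `x` to `y` one at a time.
  have key : ∀ s : Finset ι, G.Reachable x (s.piecewise y x) := by
    intro s
    induction s using Finset.induction_on with
    | empty => simp
    | insert i s _ ih =>
      rw [Finset.piecewise_insert]
      exact ih.trans (h _ _ _)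
  simpa using key Finset.univ

/-! ### Hypercubes -/

section Hypercube

variable {D : ℕ}

theorem hypercube_adj_iff {x y : Fin D → Bool} :
    (hypercube D).Adj x y ↔ ∃ i, x i ≠ y i ∧ ∀ j, j ≠ i → x j = y j := by
  change (Finset.univ.filter fun i => x i ≠ y i).card = 1 ↔ _
  rw [Finset.card_eq_one]
  refine exists_congr fun i => ?_
  simp only [Finset.ext_iff, Finset.mem_filter, Finset.mem_univ, true_and, Finset.mem_singleton]
  refine ⟨fun h => ⟨(h i).2 rfl, fun j hj => ?_⟩, fun h j => ⟨fun hj => ?_, ?_⟩⟩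
  · by_contra hne
    exact hj ((h j).1 hne)
  · by_contra hne
    exact hj (h.2 j hne)
  · rintro rfl
    exact h.1

theorem hypercube_adj_iff_eq_update {x y : Fin D → Bool} :
    (hypercube D).Adj x y ↔ ∃ i, Function.update x i (!x i) = y := by
  rw [hypercube_adj_iff]
  refine exists_congr fun i => ?_
  rw [Function.update_eq_iff]
  refine and_congr ?_ Iff.rfl
  cases x i <;> cases y i <;> simp

theorem connected_hypercube (D : ℕ) : (hypercube D).Connected := by
  refine connected_of_reachable_update fun x i c => ?_
  by_cases h : x i = c
  · rw [← h, Function.update_eq_self]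
  · refine SimpleGraph.Adj.reachable (hypercube_adj_iff_eq_update.2 ⟨i, ?_⟩)
    congr 1
    cases hx : x i <;> cases c <;> simp_all

theorem isRegularOfDegree_hypercube (D : ℕ) : (hypercube D).IsRegularOfDegree D := by
  intro x
  have himage : (hypercube D).neighborFinset x =
      Finset.univ.image fun i => Function.update x i (!x i) := by
    ext y
    simp [hypercube_adj_iff_eq_update]
  rw [← SimpleGraph.card_neighborFinset_eq_degree, himage, Finset.card_image_of_injective,
    Finset.card_univ, Fintype.card_fin]
  intro i j hij
  by_contra hne
  have := congrFun hij i
  simp [Function.update_of_ne hne] at this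

/-- A permutation of the coordinates followed by a translation, as an automorphism of the
hypercube. -/
def hypercubeIso (σ : Equiv.Perm (Fin D)) (c : Fin D → Bool) : hypercube D ≃g hypercube D where
  toFun x k := x (σ k) ^^ c k
  invFun x k := x (σ.symm k) ^^ c (σ.symm k)
  left_inv x := by ext k; simp
  right_inv x := by ext k; simp
  map_rel_iff' {x y} := by
    rw [hypercube_adj_iff, hypercube_adj_iff]
    refine σ.exists_congr fun i => ?_
    simp only [Equiv.coe_fn_mk, ne_eq, Bool.xor_left_inj]
    refine and_congr Iff.rfl (σ.forall_congr fun j => ?_)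
    rw [σ.apply_eq_iff_eq]

theorem isEdgeTransitive_hypercube (D : ℕ) : IsEdgeTransitive (hypercube D) := by
  intro e he e' he'
  induction e with | _ x y
  induction e' with | _ x' y'
  rw [SimpleGraph.mem_edgeSet, hypercube_adj_iff_eq_update] at he he'
  obtain ⟨i, rfl⟩ := he
  obtain ⟨j, rfl⟩ := he'
  -- The swap turns direction `i` into `j`, and the translation carries the permuted `x` to `x'`.
  refine ⟨hypercubeIso (Equiv.swap j i) fun k => x (Equiv.swap j i k) ^^ x' k, ?_⟩
  rw [Sym2.map_mk]
  refine congrArg₂ (fun u v => s(u, v)) ?_ ?_ <;> ext k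
  · simp [hypercubeIso]
  · by_cases hk : k = j
    · subst hk
      simp [hypercubeIso]
    · have hki : Equiv.swap j i k ≠ i := fun h =>
        hk ((Equiv.swap j i).injective (h.trans (Equiv.swap_apply_left j i).symm))
      simp [hypercubeIso, Function.update_of_ne hk, Function.update_of_ne hki]

end Hypercube

/-! ### Periodic square lattices -/

section SquareLattice

variable {D n : ℕ}

theorem squareLattice_adj_iff_eq_update (hn : 3 ≤ n) {x y : Fin D → ZMod n} :
    (squareLattice D n).Adj x y ↔
      ∃ p : Fin D × Bool, Function.update x p.1 (x p.1 + if p.2 then 1 else -1) = y := by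
  have : Fact (1 < n) := ⟨by lia⟩
  constructor
  · rintro ⟨-, i, hi | hi, hj⟩
    · refine ⟨(i, true), Function.update_eq_iff.2 ⟨?_, hj⟩⟩
      simp [hi]
    · refine ⟨(i, false), Function.update_eq_iff.2 ⟨?_, hj⟩⟩
      simp [hi]
  · rintro ⟨⟨i, b⟩, rfl⟩
    refine ⟨fun h => ?_, i, ?_, fun j hj => by simp [Function.update_of_ne hj]⟩
    · have := congrFun h i
      cases b <;> simp at this
    · cases b <;> simp

theorem connected_squareLattice [NeZero n] (hn : 3 ≤ n) : (squareLattice D n).Connected := by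
  refine connected_of_reachable_update fun x i c => ?_
  have key : ∀ k : ℕ, (squareLattice D n).Reachable x (Function.update x i (x i + k)) := by
    intro k
    induction k with
    | zero => simp
    | succ k ih =>
      refine ih.trans (SimpleGraph.Adj.reachable
        ((squareLattice_adj_iff_eq_update hn).2 ⟨(i, true), ?_⟩))
      simp [add_assoc]
  have := key (c - x i).val
  rwa [ZMod.natCast_zmod_val, add_sub_cancel] at this

theorem isRegularOfDegree_squareLattice [NeZero n] (hn : 3 ≤ n) :
    (squareLattice D n).IsRegularOfDegree (2 * D) := by
  have : Fact (1 < n) := ⟨by lia⟩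
  -- For `n = 2` the steps `1` and `-1` would coincide and the degree would drop to `D`.
  have h2 : (1 : ZMod n) + 1 ≠ 0 := by
    intro h
    have h' : ((2 : ℕ) : ZMod n) = 0 := by
      rw [← h]
      norm_num
    exact absurd (Nat.le_of_dvd (by norm_num) ((ZMod.natCast_eq_zero_iff 2 n).1 h')) (by lia)
  intro x
  have himage : (squareLattice D n).neighborFinset x = Finset.univ.image fun p : Fin D × Bool =>
      Function.update x p.1 (x p.1 + if p.2 then 1 else -1) := by
    ext y
    simp only [SimpleGraph.mem_neighborFinset, squareLattice_adj_iff_eq_update hn,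
      Finset.mem_image, Finset.mem_univ, true_and]
  rw [← SimpleGraph.card_neighborFinset_eq_degree, himage, Finset.card_image_of_injective,
    Finset.card_univ, Fintype.card_prod, Fintype.card_fin, Fintype.card_bool, mul_comm]
  rintro ⟨i, b⟩ ⟨j, b'⟩ hij
  have hi := congrFun hij i
  by_cases hne : i = j
  · subst hne
    cases b <;> cases b' <;> simp at hi ⊢
    · exact h2 (by nth_rewrite 1 [← hi]; ring)
    · exact h2 (by nth_rewrite 1 [hi]; ring)
  · cases b <;> simp [Function.update_of_ne hne] at hi

/-- A permutation of the coordinates followed by a translation, as an automorphism of the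
square lattice. -/
def squareLatticeIso (σ : Equiv.Perm (Fin D)) (c : Fin D → ZMod n) :
    squareLattice D n ≃g squareLattice D n where
  toFun x k := x (σ k) + c k
  invFun x k := x (σ.symm k) - c (σ.symm k)
  left_inv x := by ext k; simp
  right_inv x := by ext k; simp
  map_rel_iff' {x y} := by
    simp only [squareLattice, Equiv.coe_fn_mk]
    refine and_congr (not_congr ⟨fun h => ?_, ?_⟩) (σ.exists_congr fun i => ?_)
    · ext k
      simpa using congrFun h (σ.symm k)
    · rintro rfl
      rfl
    · simp only [add_left_inj, add_right_comm _ (c i) 1]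
      refine and_congr Iff.rfl (σ.forall_congr fun j => ?_)
      rw [Ne, Ne, σ.apply_eq_iff_eq]

theorem isEdgeTransitive_squareLattice (hn : 3 ≤ n) : IsEdgeTransitive (squareLattice D n) := by
  -- With every edge written as a positive step, permutations and translations suffice and no
  -- reflection is needed.
  have key : ∀ e ∈ (squareLattice D n).edgeSet,
      ∃ (x : Fin D → ZMod n) (i : Fin D), e = s(x, Function.update x i (x i + 1)) := by
    intro e he
    induction e with | _ x y
    rw [SimpleGraph.mem_edgeSet, squareLattice_adj_iff_eq_update hn] at he
    obtain ⟨⟨i, b⟩, rfl⟩ := he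
    cases b
    · refine ⟨Function.update x i (x i - 1), i, Sym2.eq_swap.trans ?_⟩
      simp [sub_eq_add_neg]
    · exact ⟨x, i, by simp⟩
  intro e he e' he'
  obtain ⟨x, i, rfl⟩ := key e he
  obtain ⟨x', j, rfl⟩ := key e' he'
  refine ⟨squareLatticeIso (Equiv.swap j i) fun k => x' k - x (Equiv.swap j i k), ?_⟩
  rw [Sym2.map_mk]
  refine congrArg₂ (fun u v => s(u, v)) ?_ ?_ <;> ext k
  · simp [squareLatticeIso]
  · by_cases hk : k = j
    · subst hk
      simp [squareLatticeIso]
      ring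
    · have hki : Equiv.swap j i k ≠ i := fun h =>
        hk ((Equiv.swap j i).injective (h.trans (Equiv.swap_apply_left j i).symm))
      simp [squareLatticeIso, Function.update_of_ne hk, Function.update_of_ne hki]

end SquareLattice

/-! ### Localization on edge-transitive graphs -/

section Main

variable {V : Type*} [Fintype V] [DecidableEq V] {G : SimpleGraph V} [DecidableRel G.Adj]

theorem OscillatesBetween.mono {c c' : ℝ} (hc : c' ≤ c) {ψ ψ' : WalkSpace G}
    (h : OscillatesBetween G c ψ ψ') : OscillatesBetween G c' ψ ψ' :=
  fun t => ⟨hc.trans (h t).1, hc.trans (h t).2⟩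

theorem StaysLocalized.mono {c c' : ℝ} (hc : c' ≤ c) {ψ : WalkSpace G}
    (h : StaysLocalized G c ψ) : StaysLocalized G c' ψ :=
  fun t => hc.trans (h t)

theorem HasResistanceDistance.oscillatesBetween {a b : V} (h : G.Adj a b) {r : ℝ}
    (hr : HasResistanceDistance G.bipartiteDoubleCover (Sum.inl a) (Sum.inr b) r) :
    OscillatesBetween G (1 - 2 * r) (ket G h) (-ket G h.symm) := by
  have := oscillatesBetween_ket h
  rw [flipWeight_ket h hr] at this
  exact this.mono (by linarith)

theorem HasResistanceDistance.staysLocalized {a b : V} (h : G.Adj a b) {r : ℝ}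
    (hr : HasResistanceDistance G a b r) : StaysLocalized G (1 - 2 * r) (edgeState G h) := by
  have := staysLocalized_edgeState h
  rw [flipWeight_edgeState h hr] at this
  exact this.mono (by linarith)

theorem oscillatesBetween_of_isEdgeTransitive (hG : G.Connected) {d : ℕ}
    (hd : G.IsRegularOfDegree d) (ht : IsEdgeTransitive G) {a b : V} (h : G.Adj a b) :
    OscillatesBetween G (1 - 2 * ((2 * (Fintype.card V : ℝ) - 1) / (d * Fintype.card V)))
      (ket G h) (-ket G h.symm) := by
  by_cases hb : G.IsBipartite
  -- The resistance is smaller in the bipartite case, so the non-bipartite bound holds for both.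
  · refine (((hasResistanceDistance_of_isEdgeTransitive hG hd ht h).bipartiteDoubleCover hb
      h).oscillatesBetween h).mono ?_
    have : ((Fintype.card V : ℝ) - 1) / (d * Fintype.card V / 2) =
        (2 * (Fintype.card V : ℝ) - 2) / (d * Fintype.card V) := by
      rw [div_div_eq_mul_div]
      ring
    rw [this]
    gcongr
    norm_num
  · exact (hasResistanceDistance_bipartiteDoubleCover_of_not_isBipartite hG hd ht hb
      h).oscillatesBetween h

/-- The two resistances fall short of `2 / d` by `1 / (d * N)` and `2 / (d * N)`. -/
theorem one_sub_four_div_lt {d N : ℝ} (hd : 0 < d) (hN : 0 < N) :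
    1 - 4 / d < 1 - 2 * ((2 * N - 1) / (d * N)) ∧ 1 - 4 / d < 1 - 2 * ((N - 1) / (d * N / 2)) := by
  have h1 : 2 * ((2 * N - 1) / (d * N)) = 4 / d - 2 / (d * N) := by
    field_simp
    ring
  have h2 : 2 * ((N - 1) / (d * N / 2)) = 4 / d - 4 / (d * N) := by
    field_simp
    ring
  have h3 : 0 < 2 / (d * N) := by positivity
  have h4 : 0 < 4 / (d * N) := by positivity
  rw [h1, h2]
  constructor <;> linarith

theorem SimpleGraph.IsRegularOfDegree.pos_of_adj {V : Type*} [Fintype V] {G : SimpleGraph V}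
    [DecidableRel G.Adj] {d : ℕ} (hd : G.IsRegularOfDegree d) {a b : V} (h : G.Adj a b) :
    (0 : ℝ) < d ∧ (0 : ℝ) < Fintype.card V := by
  constructor
  · rw [← hd a]
    exact_mod_cast (G.degree_pos_iff_exists_adj a).2 ⟨b, h⟩
  · exact_mod_cast Fintype.card_pos_iff.2 ⟨a⟩

theorem localizesOnEdges_of_isEdgeTransitive (hG : G.Connected) {d : ℕ}
    (hd : G.IsRegularOfDegree d) (ht : IsEdgeTransitive G) :
    LocalizesOnEdges G (1 - 4 / (d : ℝ)) := by
  intro a b h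
  -- The edge forces `d > 0`; graphs of degree zero, such as the one-vertex complete graph, are
  -- covered vacuously.
  obtain ⟨hd0, hN⟩ := hd.pos_of_adj h
  obtain ⟨h1, h2⟩ := one_sub_four_div_lt hd0 hN
  exact ⟨(oscillatesBetween_of_isEdgeTransitive hG hd ht h).mono h1.le,
    ((hasResistanceDistance_of_isEdgeTransitive hG hd ht h).staysLocalized h).mono h2.le⟩

theorem not_isBipartite_top {V : Type*} [Fintype V] (hV : 3 ≤ Fintype.card V) :
    ¬ (⊤ : SimpleGraph V).IsBipartite := by
  rintro ⟨c⟩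
  have := Fintype.card_le_of_injective c c.injective_of_top_hom
  rw [Fintype.card_fin] at this
  lia

end Main

theorem mainTheorem8 :
    -- connected `d`-regular edge-transitive graphs on `N` vertices
    (∀ (V : Type*) [Fintype V] [DecidableEq V] (G : SimpleGraph V) [DecidableRel G.Adj] (d N : ℕ),
      G.Connected → G.IsRegularOfDegree d → IsEdgeTransitive G → Fintype.card V = N →
      ∀ (a b : V) (h : G.Adj a b),
        -- resistance across an edge, in `G` and in the bipartite double graph of `G`
        HasResistanceDistance G a b (((N : ℝ) - 1) / (d * N / 2)) ∧
        (¬ G.IsBipartite → HasResistanceDistance G.bipartiteDoubleCover (Sum.inl a) (Sum.inr b)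
          ((2 * (N : ℝ) - 1) / (d * N))) ∧
        (G.IsBipartite → HasResistanceDistance G.bipartiteDoubleCover (Sum.inl a) (Sum.inr b)
          (((N : ℝ) - 1) / (d * N / 2))) ∧
        -- flip weights
        flipWeight G (edgeState G h) = ((d : ℝ) * N - 2 * N + 2) / (d * N) ∧
        (¬ G.IsBipartite → flipWeight G (ket G h) = ((d : ℝ) * N - 2 * N + 1) / (d * N)) ∧
        (G.IsBipartite → flipWeight G (ket G h) = ((d : ℝ) * N - 2 * N + 2) / (d * N)) ∧
        -- oscillation of `|ab⟩` with `-|ba⟩` and localization of `(|ab⟩ - |ba⟩) / √2`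
        OscillatesBetween G (1 - 2 * ((2 * (N : ℝ) - 1) / (d * N))) (ket G h) (-ket G h.symm) ∧
        (G.IsBipartite → OscillatesBetween G (1 - 2 * (((N : ℝ) - 1) / (d * N / 2)))
          (ket G h) (-ket G h.symm)) ∧
        StaysLocalized G (1 - 2 * (((N : ℝ) - 1) / (d * N / 2))) (edgeState G h) ∧
        1 - 4 / (d : ℝ) < 1 - 2 * ((2 * (N : ℝ) - 1) / (d * N)) ∧
        1 - 4 / (d : ℝ) < 1 - 2 * (((N : ℝ) - 1) / (d * N / 2))) ∧
    -- complete graphs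
    (∀ n : ℕ, 1 ≤ n →
      (⊤ : SimpleGraph (Fin n)).Connected ∧
      (⊤ : SimpleGraph (Fin n)).IsRegularOfDegree (n - 1) ∧
      IsEdgeTransitive (⊤ : SimpleGraph (Fin n)) ∧
      LocalizesOnEdges (⊤ : SimpleGraph (Fin n)) (1 - 4 / ((n : ℝ) - 1))) ∧
    -- regular complete bipartite graphs
    (∀ n : ℕ, 1 ≤ n →
      (completeBipartiteGraph (Fin n) (Fin n)).Connected ∧
      (completeBipartiteGraph (Fin n) (Fin n)).IsRegularOfDegree n ∧
      IsEdgeTransitive (completeBipartiteGraph (Fin n) (Fin n)) ∧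
      LocalizesOnEdges (completeBipartiteGraph (Fin n) (Fin n)) (1 - 4 / (n : ℝ))) ∧
    -- hypercubes
    (∀ D : ℕ,
      (hypercube D).Connected ∧ (hypercube D).IsRegularOfDegree D ∧
      IsEdgeTransitive (hypercube D) ∧ LocalizesOnEdges (hypercube D) (1 - 4 / (D : ℝ))) ∧
    -- square lattices of arbitrary dimension `D`, whose degree is `2 D`
    (∀ (D n : ℕ) [NeZero n], 3 ≤ n →
      (squareLattice D n).Connected ∧ (squareLattice D n).IsRegularOfDegree (2 * D) ∧
      IsEdgeTransitive (squareLattice D n) ∧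
      LocalizesOnEdges (squareLattice D n) (1 - 4 / (2 * (D : ℝ)))) ∧
    -- the walk on the complete graph on `N` vertices, started in `|ab⟩`
    (∀ (V : Type*) [Fintype V] [DecidableEq V] (N : ℕ), Fintype.card V = N →
      ∀ (a b : V) (h : (⊤ : SimpleGraph V).Adj a b),
        (3 ≤ N → flipWeight ⊤ (ket ⊤ h) = 1 - 1 / ((N : ℝ) - 1) - 1 / N) ∧
        ‖⟪ket ⊤ h, uniformState ⊤⟫_ℂ‖ ^ 2 = 1 / ((N : ℝ) * (N - 1)) ∧
        (∀ t : ℕ, 1 - 4 / (N : ℝ) ≤ ‖⟪ket ⊤ h, (walkStep ⊤ ^ (2 * t)) (ket ⊤ h)⟫_ℂ‖) ∧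
        (∀ t : ℕ, 1 - 2 / ((N : ℝ) - 1) - 2 / N ≤
          ‖⟪ket ⊤ h.symm, (walkStep ⊤ ^ (2 * t + 1)) (ket ⊤ h)⟫_ℂ‖)) := by
  refine ⟨?_, ?_, ?_, ?_, ?_, ?_⟩
  · intro V _ _ G _ d N hG hd ht hN a b h
    subst hN
    obtain ⟨hd0, hN0⟩ := hd.pos_of_adj h
    obtain ⟨hlt, hlt'⟩ := one_sub_four_div_lt hd0 hN0
    have hres := hasResistanceDistance_of_isEdgeTransitive hG hd ht h
    have hres' : ¬ G.IsBipartite → _ := fun hb =>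
      hasResistanceDistance_bipartiteDoubleCover_of_not_isBipartite hG hd ht hb h
    have hresb : G.IsBipartite → _ := fun hb => hres.bipartiteDoubleCover hb h
    refine ⟨hres, hres', hresb, ?_, fun hb => ?_, fun hb => ?_,
      oscillatesBetween_of_isEdgeTransitive hG hd ht h,
      fun hb => (hresb hb).oscillatesBetween h, hres.staysLocalized h, hlt, hlt'⟩
    · rw [flipWeight_edgeState h hres]
      field_simp
      ring
    · rw [flipWeight_ket h (hres' hb)]
      field_simp
      ring
    · rw [flipWeight_ket h (hresb hb)]
      field_simp
      ring
  · intro n hn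
    have : Nonempty (Fin n) := ⟨⟨0, hn⟩⟩
    have hd : (⊤ : SimpleGraph (Fin n)).IsRegularOfDegree (n - 1) := by
      simpa using SimpleGraph.IsRegularOfDegree.top (V := Fin n)
    refine ⟨SimpleGraph.connected_top, hd, isEdgeTransitive_top _, ?_⟩
    have := localizesOnEdges_of_isEdgeTransitive SimpleGraph.connected_top hd
      (isEdgeTransitive_top _)
    rwa [Nat.cast_sub hn, Nat.cast_one] at this
  · intro n hn
    have : Nonempty (Fin n) := ⟨⟨0, hn⟩⟩
    exact ⟨connected_completeBipartiteGraph _ _, isRegularOfDegree_completeBipartiteGraph n,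
      isEdgeTransitive_completeBipartiteGraph _ _,
      localizesOnEdges_of_isEdgeTransitive (connected_completeBipartiteGraph _ _)
        (isRegularOfDegree_completeBipartiteGraph n) (isEdgeTransitive_completeBipartiteGraph _ _)⟩
  · intro D
    exact ⟨connected_hypercube D, isRegularOfDegree_hypercube D, isEdgeTransitive_hypercube D,
      localizesOnEdges_of_isEdgeTransitive (connected_hypercube D) (isRegularOfDegree_hypercube D)
        (isEdgeTransitive_hypercube D)⟩
  · intro D n _ hn
    refine ⟨connected_squareLattice hn, isRegularOfDegree_squareLattice hn,
      isEdgeTransitive_squareLattice hn, ?_⟩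
    have := localizesOnEdges_of_isEdgeTransitive (connected_squareLattice (D := D) hn)
      (isRegularOfDegree_squareLattice hn) (isEdgeTransitive_squareLattice hn)
    simpa using this
  · intro V _ _ N hN a b h
    subst hN
    have : Nonempty V := ⟨a⟩
    have : Nonempty (⊤ : SimpleGraph V).Dart := ⟨⟨(a, b), h⟩⟩
    have hd : (⊤ : SimpleGraph V).IsRegularOfDegree (Fintype.card V - 1) :=
      SimpleGraph.IsRegularOfDegree.top
    have ht := isEdgeTransitive_top V
    have h2 : 2 ≤ Fintype.card V :=
      Fintype.one_lt_card_iff.2 ⟨a, b, h.ne⟩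
    have h2' : (2 : ℝ) ≤ Fintype.card V := by exact_mod_cast h2
    have hcast : ((Fintype.card V - 1 : ℕ) : ℝ) = (Fintype.card V : ℝ) - 1 := by
      rw [Nat.cast_sub (by lia), Nat.cast_one]
    have hdart : (Fintype.card (⊤ : SimpleGraph V).Dart : ℝ) =
        (Fintype.card V : ℝ) * (Fintype.card V - 1) := by
      rw [SimpleGraph.dart_card_eq_sum_degrees, Finset.sum_congr rfl fun x _ => hd x]
      simp [hcast]
    have hweight : 3 ≤ Fintype.card V → flipWeight ⊤ (ket ⊤ h) =
        1 - 1 / ((Fintype.card V : ℝ) - 1) - 1 / Fintype.card V := fun h3 => by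
      rw [flipWeight_ket h (hasResistanceDistance_bipartiteDoubleCover_of_not_isBipartite
        SimpleGraph.connected_top hd ht (not_isBipartite_top h3) h), hcast]
      have : (Fintype.card V : ℝ) - 1 ≠ 0 := by linarith
      field_simp
      ring
    have huniform := norm_inner_ket_uniformState_sq h
    rw [hdart] at huniform
    refine ⟨hweight, huniform, fun t => ?_, fun t => ?_⟩
    -- For two vertices the graph is bipartite and the weight formula unavailable, but the bound is
    -- `-1`.
    · rcases h2.eq_or_lt with h3 | h3
      · rw [← h3]
        exact le_trans (by norm_num) (norm_nonneg _)
      -- Flip weight and uniform weight add up to `1 - 2 / N`.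
      · have hle := two_mul_flipWeight_add_sub_one_le t (norm_ket h)
        rw [norm_inner_symm, huniform, hweight h3] at hle
        refine le_trans (le_of_eq ?_) hle
        have : (Fintype.card V : ℝ) - 1 ≠ 0 := by linarith
        field_simp
        ring
    -- With `d = N - 1` the resistance `(2 * N - 1) / (d * N)` splits as `1 / (N - 1) + 1 / N`.
    · have hle := (oscillatesBetween_of_isEdgeTransitive SimpleGraph.connected_top hd ht h t).2
      rw [inner_neg_left, norm_neg, hcast] at hle
      refine le_trans (le_of_eq ?_) hle
      have : (Fintype.card V : ℝ) - 1 ≠ 0 := by linarith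
      field_simp
      ring
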